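/- Let $n\ge 1$ be an integer, let $k\ge\frac{n-1}{2n}$ be real, and put $\alpha=kn-\frac n2$. Let $$d\mu_{k,n}(x)=\frac{1}{2\Gamma(\alpha+1)}\Big(\frac n2\Big)^{\alpha}|x|^{2k+\frac2n-2}\,dx$$ on $\mathbb{R}$, write $L^p_{k,n}=L^p(\mathbb{R},d\mu_{k,n})$ for $1\le p\le\infty$ (complex-valued functions), and let $$\mathcal{F}_{k,n}f(\lambda)=\int_{\mathbb{R}}f(x)\,B_{k,n}(x,\lambda)\,d\mu_{k,n}(x),$$ $$B_{k,n}(x,\lambda)=j_\alpha\big(n|\lambda x|^{1/n}\big)+(-i)^n\Big(\frac n2\Big)^n\frac{\Gamma(\alpha+1)}{\Gamma(\alpha+n+1)}\,\lambda x\,j_{\alpha+n}\big(n|\lambda x|^{1/n}\big),$$ where $j_\nu(z)=\Gamma(\nu+1)\sum_{m=0}^\infty\frac{(-1)^m}{m!\,\Gamma(\nu+m+1)}\big(\frac z2\big)^{2m}$ is the normalized Bessel function. Let $a,b>0$ and $1\le p,q\le\infty$ with $\min(p,q)<\infty$. For a measurable function $f:\mathbb{R}\to\mathbb{C}$ consider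 the conditions $$\big\|e^{na|x|^{2/n}}f\big\|_{L^p_{k,n}}<\infty\qquad\text{and}\qquad\big\|e^{nb|x|^{2/n}}\mathcal{F}_{k,n}f\big\|_{L^q_{k,n}}<\infty;$$ the first of these implies $f\in L^1_{k,n}$, so that $\mathcal{F}_{k,n}f$ is well defined. 1. If $ab\ge\frac14$, then every measurable $f$ satisfying both conditions vanishes almost everywhere. 2. If $ab<\frac14$, then there are infinitely many linearly independent (modulo almost everywhere equality) measurable functions $f$ satisfying both conditions. -/

import Mathlib

open MeasureTheory
open scoped ENNReal

noncomputable section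

namespace GenFourier

/-- The index `α = k n - n / 2` of the Bessel function in the even part of the kernel. -/
def index (k : ℝ) (n : ℕ) : ℝ := k * n - n / 2

/-- The normalized Bessel function
`j_α(z) = Γ(α+1) ∑_{m ≥ 0} (-1)^m / (m! Γ(α+m+1)) (z/2)^(2m)`, for real `α > -1`. -/
def normBessel (α : ℝ) (z : ℂ) : ℂ :=
  (Real.Gamma (α + 1) : ℂ) *
    ∑' m : ℕ, (-1 : ℂ) ^ m / ((m.factorial : ℂ) * (Real.Gamma (α + m + 1) : ℂ)) *
      (z / 2) ^ (2 * m)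

/-- The kernel `B_{k,n}(x, y)` of the `(k, 2/n)`-generalized Fourier transform. -/
def kernel (k : ℝ) (n : ℕ) (x y : ℝ) : ℂ :=
  normBessel (index k n) (((n : ℝ) * |y * x| ^ (1 / (n : ℝ)) : ℝ) : ℂ) +
    (-Complex.I) ^ n * ((n : ℂ) / 2) ^ n *
      ((Real.Gamma (index k n + 1) / Real.Gamma (index k n + n + 1) : ℝ) : ℂ) *
      ((y * x : ℝ) : ℂ) *
      normBessel (index k n + n) (((n : ℝ) * |y * x| ^ (1 / (n : ℝ)) : ℝ) : ℂ)

/-- The weighted measure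
`dμ_{k,n}(x) = (2 Γ(kn - n/2 + 1))⁻¹ (n/2)^(kn - n/2) |x|^(2k + 2/n - 2) dx` on `ℝ`. -/
def weightedMeasure (k : ℝ) (n : ℕ) : Measure ℝ :=
  (volume : Measure ℝ).withDensity fun x =>
    ENNReal.ofReal
      (1 / (2 * Real.Gamma (index k n + 1)) * ((n : ℝ) / 2) ^ index k n *
        |x| ^ (2 * k + 2 / (n : ℝ) - 2))

/-- The `(k, 2/n)`-generalized Fourier transform
`F_{k,n} f (y) = ∫ f(x) B_{k,n}(x, y) dμ_{k,n}(x)`. -/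
def transform (k : ℝ) (n : ℕ) (f : ℝ → ℂ) (y : ℝ) : ℂ :=
  ∫ x, f x * kernel k n x y ∂(weightedMeasure k n)

/-- `‖e^{n c |x|^(2/n)} g‖` in `L^r(μ_{k,n})`, as an extended nonnegative real
(the essential supremum norm when `r = ∞`). -/
def gaussWeightedNorm (k : ℝ) (n : ℕ) (c : ℝ) (r : ℝ≥0∞) (g : ℝ → ℂ) : ℝ≥0∞ :=
  eLpNorm (fun x => (Real.exp (n * c * |x| ^ (2 / (n : ℝ))) : ℂ) * g x) r (weightedMeasure k n)

end GenFourier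

end

/-! Put s = |x|^(1/n) and α = `index k n`. The kernel splits by parity, so the transform of f at y
is E(|y|^(1/n)) plus a nonzero constant times y·O(|y|^(1/n)), where E is the Bessel transform of
order α of f and O that of order α + n of x·f (`transform_eq`). E sees only the even part of f, O
only its odd part, and reflection y ↦ -y separates the two bounds on the transform.

The first condition, after a polynomial loss that makes p irrelevant (`exists_hasGaussianDecay`),
and the bound |j_ν(z)| ≤ e^|Im z| (`norm_normBessel_le`) make each Bessel transform an even entire
function of size (1+|z|)^M exp(n (Im z)²/(4a)). Multiplying by exp(n z²/(4a)) gives G, of polynomial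
growth on the imaginary axis. If ab ≥ 1/4, the second condition puts s^N G(s) in L^q on the
half-line, with N = 0 or n. A borderline Phragmén–Lindelöf argument for a primitive of G, followed
by Liouville, shows that G is a polynomial (`exists_polynomial_of_gaussian_growth`).

A polynomial in s lying in L^q is constant, and zero if q < ∞, because neighbourhoods of infinity
have infinite measure. For O the extra factor s^n, n ≥ 1, forces zero for every q. For E the only
surviving case is q = ∞: then f has even part C·exp(-na s²), and the first condition with p < ∞
forces C = 0. Injectivity of the Bessel transform (`add_neg_eq_zero_of_besselTransform_eq_zero`)
follows from vanishing moments and uniqueness of characteristic functions.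

If ab < 1/4, the Gaussians exp(-nc|x|^(2/n)) with a < c < 1/(4b) satisfy both conditions, since
their transforms are multiples of the Gaussian with parameter 1/(4c). -/

namespace ProbabilityTheory

/-! ### Normalized Bessel functions and Poisson's integral. -/

lemma betaPDFReal_nonneg {a b : ℝ} (ha : 0 < a) (hb : 0 < b) (x : ℝ) : 0 ≤ betaPDFReal a b x := by
  by_cases h : 0 < x ∧ x < 1
  · exact (betaPDFReal_pos h.1 h.2 ha hb).le
  · simp [betaPDFReal, h]

lemma integral_betaPDFReal {a b : ℝ} (ha : 0 < a) (hb : 0 < b) : ∫ x, betaPDFReal a b x = 1 := by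
  rw [integral_eq_lintegral_of_nonneg_ae (ae_of_all _ (betaPDFReal_nonneg ha hb))
    (measurable_betaPDFReal a b).aestronglyMeasurable]
  have := lintegral_betaPDF_eq_one ha hb
  simp only [betaPDF] at this
  simp [this]

/-- The moments of the beta distribution. -/
lemma integral_pow_betaMeasure {a b : ℝ} (ha : 0 < a) (hb : 0 < b) (m : ℕ) :
    ∫ x, x ^ m ∂(betaMeasure a b) = beta (a + m) b / beta a b := by
  have h1 := beta_pos ha hb
  have ham : 0 < a + m := by positivity
  have h2 := beta_pos ham hb
  rw [betaMeasure]
  unfold betaPDF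
  rw [integral_withDensity_eq_integral_toReal_smul
    ((measurable_betaPDFReal a b).ennreal_ofReal) (ae_of_all _ fun _ => ENNReal.ofReal_lt_top)]
  have : ∀ x, (ENNReal.ofReal (betaPDFReal a b x)).toReal • x ^ m =
      beta (a + m) b / beta a b * betaPDFReal (a + m) b x := by
    intro x
    rw [ENNReal.toReal_ofReal (betaPDFReal_nonneg ha hb x), smul_eq_mul]
    by_cases h : 0 < x ∧ x < 1
    · simp only [betaPDFReal, if_pos h]
      rw [show a + m - 1 = (a - 1) + m by ring, Real.rpow_add h.1, Real.rpow_natCast]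
      field_simp
    · simp [betaPDFReal, h]
  simp_rw [this]
  rw [integral_const_mul, integral_betaPDFReal ham hb, mul_one]

lemma ae_betaMeasure (a b : ℝ) : ∀ᵐ x ∂(betaMeasure a b), x ∈ Set.Icc (0 : ℝ) 1 := by
  unfold betaMeasure betaPDF
  rw [ae_withDensity_iff (measurable_betaPDFReal a b).ennreal_ofReal]
  refine ae_of_all _ fun x hx => ?_
  by_contra h
  apply hx
  have : ¬ (0 < x ∧ x < 1) := fun h' => h ⟨h'.1.le, h'.2.le⟩
  simp [betaPDFReal, this]

end ProbabilityTheory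

namespace GenFourier

open ProbabilityTheory

/-- The modulus of the coefficient of `z ^ (2 m)` in the power series of `normBessel ν`. -/
noncomputable def besselCoeff (ν : ℝ) (m : ℕ) : ℝ :=
  Real.Gamma (ν + 1) / (m.factorial * Real.Gamma (ν + m + 1) * 4 ^ m)

lemma normBessel_eq_tsum (ν : ℝ) (z : ℂ) :
    normBessel ν z = ∑' m : ℕ, (-1 : ℂ) ^ m * besselCoeff ν m * z ^ (2 * m) := by
  rw [normBessel, ← tsum_mul_left]
  refine tsum_congr fun m => ?_
  simp only [besselCoeff]
  push_cast
  rw [div_pow, pow_mul (2 : ℂ) 2 m]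
  norm_num
  ring

lemma besselCoeff_zero {ν : ℝ} (hν : -(1 / 2) ≤ ν) : besselCoeff ν 0 = 1 := by
  have : Real.Gamma (ν + 1) ≠ 0 := (Real.Gamma_pos_of_pos (by linarith)).ne'
  simp [besselCoeff, this]

lemma besselCoeff_pos {ν : ℝ} (hν : -(1 / 2) ≤ ν) (m : ℕ) : 0 < besselCoeff ν m := by
  have h1 : 0 < Real.Gamma (ν + 1) := Real.Gamma_pos_of_pos (by linarith)
  have h2 : 0 < Real.Gamma (ν + m + 1) := Real.Gamma_pos_of_pos
    (by have : (0 : ℝ) ≤ m := m.cast_nonneg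
        linarith)
  unfold besselCoeff
  positivity

lemma besselCoeff_succ {ν : ℝ} (hν : -(1 / 2) ≤ ν) (m : ℕ) :
    besselCoeff ν (m + 1) = besselCoeff ν m / (4 * (m + 1) * (ν + m + 1)) := by
  have h0 : 0 < ν + m + 1 := by
    have : (0 : ℝ) ≤ m := m.cast_nonneg
    linarith
  have h2 : 0 < Real.Gamma (ν + m + 1) := Real.Gamma_pos_of_pos h0
  unfold besselCoeff
  rw [show ν + (m + 1 : ℕ) + 1 = (ν + m + 1) + 1 by push_cast; ring, Real.Gamma_add_one h0.ne',
    Nat.factorial_succ]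
  push_cast
  field_simp
  ring

/-- The coefficients of the normalized Bessel function are, up to the factor `1 / (2 m)!`, the
moments of a probability measure on `[0, 1]` (Poisson's integral representation). -/
lemma exists_measure_besselCoeff {ν : ℝ} (hν : -(1 / 2) ≤ ν) :
    ∃ P : Measure ℝ, IsProbabilityMeasure P ∧ (∀ᵐ v ∂P, v ∈ Set.Icc (0 : ℝ) 1) ∧
      ∀ m : ℕ, besselCoeff ν m = (∫ v, v ^ m ∂P) / (2 * m).factorial := by
  -- The numbers (2m)!·`besselCoeff ν m` obey this first-order recursion, so it suffices to find a
  -- probability measure whose moments obey it.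
  have key : ∀ M : ℕ → ℝ, M 0 = 1 →
      (∀ m : ℕ, M (m + 1) = M m * ((m + 1 / 2) / (ν + m + 1))) →
      ∀ m : ℕ, besselCoeff ν m = M m / (2 * m).factorial := by
    intro M h0 hM m
    induction m with
    | zero => simp [besselCoeff_zero hν, h0]
    | succ m ih =>
      have h1 : 0 < ν + m + 1 := by
        have : (0 : ℝ) ≤ m := m.cast_nonneg
        linarith
      rw [besselCoeff_succ hν, ih, hM, show 2 * (m + 1) = 2 * m + 1 + 1 by ring,
        Nat.factorial_succ, Nat.factorial_succ]
      push_cast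
      field_simp
      ring
  rcases hν.eq_or_lt with h | h
  -- At ν = -1/2 the beta distribution degenerates to a point mass at 1, and the Bessel function is
  -- the cosine.
  · refine ⟨Measure.dirac 1, inferInstance, by simp, key _ (by simp) fun m => ?_⟩
    have : ν + m + 1 = m + 1 / 2 := by rw [← h]; ring
    rw [this]
    have : (m : ℝ) + 1 / 2 ≠ 0 := by positivity
    rw [div_self this]
    simp
  · have hb : 0 < ν + 1 / 2 := by linarith
    have hP := isProbabilityMeasureBeta (α := 1 / 2) (by norm_num) hb
    refine ⟨betaMeasure (1 / 2) (ν + 1 / 2), hP, ae_betaMeasure _ _, key _ (by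
      simp only [pow_zero, integral_const, probReal_univ, smul_eq_mul, mul_one]) fun m => ?_⟩
    rw [integral_pow_betaMeasure (by norm_num) hb, integral_pow_betaMeasure (by norm_num) hb]
    have hm : (0 : ℝ) < 1 / 2 + m := by positivity
    have h1 : 0 < ν + m + 1 := by linarith [hm]
    unfold beta
    rw [show (1 / 2 : ℝ) + (m + 1 : ℕ) = (1 / 2 + m) + 1 by push_cast; ring,
      show (1 / 2 : ℝ) + m + 1 + (ν + 1 / 2) = (ν + m + 1) + 1 by ring,
      show (1 / 2 : ℝ) + m + (ν + 1 / 2) = ν + m + 1 by ring,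
      Real.Gamma_add_one hm.ne', Real.Gamma_add_one h1.ne']
    have := (Real.Gamma_pos_of_pos h1).ne'
    field_simp
    ring

/-- Moments of a probability measure on [0, 1] are at most 1; hence the series is dominated by that
of cosh. -/
lemma besselCoeff_le {ν : ℝ} (hν : -(1 / 2) ≤ ν) (m : ℕ) :
    besselCoeff ν m ≤ 1 / (2 * m).factorial := by
  obtain ⟨P, hP, h1, h2⟩ := exists_measure_besselCoeff hν
  rw [h2]
  gcongr
  calc ∫ v, v ^ m ∂P ≤ ∫ v, (1 : ℝ) ∂P := by
        refine integral_mono_of_nonneg ?_ (integrable_const _) ?_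
        · filter_upwards [h1] with v hv using pow_nonneg hv.1 m
        · filter_upwards [h1] with v hv using pow_le_one₀ hv.1 hv.2
    _ = 1 := by simp

lemma summable_besselCoeff {ν : ℝ} (hν : -(1 / 2) ≤ ν) (r : ℝ) :
    Summable fun m : ℕ => besselCoeff ν m * r ^ (2 * m) := by
  refine Summable.of_nonneg_of_le (fun m => ?_) (fun m => ?_) (Real.hasSum_cosh r).summable
  · exact mul_nonneg (besselCoeff_pos hν m).le (by rw [pow_mul]; positivity)
  · rw [div_eq_inv_mul, ← one_div]
    exact mul_le_mul_of_nonneg_right (besselCoeff_le hν m) (by rw [pow_mul]; positivity)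

lemma tsum_besselCoeff_le {ν : ℝ} (hν : -(1 / 2) ≤ ν) {r : ℝ} (hr : 0 ≤ r) :
    ∑' m : ℕ, besselCoeff ν m * r ^ (2 * m) ≤ Real.exp r := by
  calc ∑' m : ℕ, besselCoeff ν m * r ^ (2 * m) ≤ Real.cosh r := by
        refine (summable_besselCoeff hν r).tsum_le_of_sum_le fun s => ?_
        refine le_trans (Finset.sum_le_sum fun m _ => ?_)
          ((Real.hasSum_cosh r).summable.sum_le_tsum s fun m _ => by positivity) |>.trans
          (Real.hasSum_cosh r).tsum_eq.le
        rw [div_eq_inv_mul, ← one_div]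
        exact mul_le_mul_of_nonneg_right (besselCoeff_le hν m) (by rw [pow_mul]; positivity)
    _ ≤ Real.exp r := by
        rw [Real.cosh_eq]
        have : Real.exp (-r) ≤ Real.exp r := Real.exp_le_exp.2 (by linarith)
        linarith

lemma norm_besselTerm {ν : ℝ} (hν : -(1 / 2) ≤ ν) (z : ℂ) (m : ℕ) :
    ‖(-1 : ℂ) ^ m * besselCoeff ν m * z ^ (2 * m)‖ = besselCoeff ν m * ‖z‖ ^ (2 * m) := by
  simp [abs_of_pos (besselCoeff_pos hν m)]

lemma hasSum_normBessel {ν : ℝ} (hν : -(1 / 2) ≤ ν) (z : ℂ) :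
    HasSum (fun m : ℕ => (-1 : ℂ) ^ m * besselCoeff ν m * z ^ (2 * m)) (normBessel ν z) := by
  rw [normBessel_eq_tsum]
  refine (Summable.of_norm ?_).hasSum
  simp_rw [norm_besselTerm hν]
  exact summable_besselCoeff hν _

lemma norm_cos_le_exp_abs_im (w : ℂ) : ‖Complex.cos w‖ ≤ Real.exp |w.im| := by
  rw [Complex.cos]
  have h1 : ‖Complex.exp (w * Complex.I)‖ ≤ Real.exp |w.im| := by
    rw [Complex.norm_exp]
    simpa using neg_le_abs w.im
  have h2 : ‖Complex.exp (-w * Complex.I)‖ ≤ Real.exp |w.im| := by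
    rw [Complex.norm_exp]
    simpa using le_abs_self w.im
  rw [norm_div, Complex.norm_ofNat]
  linarith [norm_add_le (Complex.exp (w * Complex.I)) (Complex.exp (-w * Complex.I))]

lemma hasSum_of_forall_eq {f g : ℕ → ℂ} {a : ℂ} (h : HasSum f a) (e : ∀ m, g m = f m) :
    HasSum g a := by
  rwa [funext e]

/-- The moment representation sums to j_ν(z) = ∫ cos(z√v) dP(v) with √v ≤ 1. The bound involves Im z
alone, which the termwise estimate by cosh |z| would not give. -/
lemma norm_normBessel_le {ν : ℝ} (hν : -(1 / 2) ≤ ν) (z : ℂ) :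
    ‖normBessel ν z‖ ≤ Real.exp |z.im| := by
  obtain ⟨P, hP, h1, h2⟩ := exists_measure_besselCoeff hν
  have hsum : HasSum (fun m : ℕ => ∫ v, (-1 : ℂ) ^ m * (z ^ (2 * m) / (2 * m).factorial) *
      ((v ^ m : ℝ) : ℂ) ∂P) (∫ v, Complex.cos (z * (√v : ℝ)) ∂P) := by
    have hc := (Real.hasSum_cosh ‖z‖).summable
    refine hasSum_integral_of_dominated_convergence
      (fun m _ => ‖z‖ ^ (2 * m) / (2 * m).factorial) (fun m => ?_) (fun m => ?_) ?_ ?_ ?_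
    · exact (by fun_prop : Measurable _).aestronglyMeasurable
    · filter_upwards [h1] with v hv
      have hv' : |v| ^ m ≤ 1 := pow_le_one₀ (abs_nonneg v) (by rw [abs_of_nonneg hv.1]; exact hv.2)
      have : 0 ≤ ‖z‖ ^ (2 * m) / (2 * m).factorial := by positivity
      simpa using mul_le_mul_of_nonneg_left hv' this
    · exact ae_of_all _ fun _ => hc
    · exact integrable_const _
    · filter_upwards [h1] with v hv
      refine hasSum_of_forall_eq (Complex.hasSum_cos (z * (√v : ℝ))) fun m => ?_
      rw [mul_pow, pow_mul ((√v : ℝ) : ℂ), ← Complex.ofReal_pow (√v), Real.sq_sqrt hv.1]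
      push_cast
      ring
  have heq : normBessel ν z = ∫ v, Complex.cos (z * (√v : ℝ)) ∂P := by
    refine (hasSum_normBessel hν z).unique (hasSum_of_forall_eq hsum fun m => ?_)
    rw [integral_const_mul, integral_complex_ofReal, h2 m]
    push_cast
    ring
  rw [heq]
  refine (norm_integral_le_of_norm_le_const (C := Real.exp |z.im|) ?_).trans (by simp)
  filter_upwards [h1] with v hv
  refine (norm_cos_le_exp_abs_im _).trans (Real.exp_le_exp.2 ?_)
  have : (z * (√v : ℝ)).im = z.im * √v := by simp
  rw [this, abs_mul, abs_of_nonneg (Real.sqrt_nonneg v)]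
  have : √v ≤ 1 := Real.sqrt_le_one.2 hv.2
  exact mul_le_of_le_one_right (abs_nonneg _) this

lemma differentiable_tsum_even {c : ℕ → ℂ} (hc : ∀ r : ℝ, Summable fun m => ‖c m‖ * r ^ (2 * m)) :
    Differentiable ℂ fun z : ℂ => ∑' m, c m * z ^ (2 * m) := by
  intro z
  have : DifferentiableOn ℂ (fun z : ℂ => ∑' m, c m * z ^ (2 * m)) (Metric.ball 0 (‖z‖ + 1)) := by
    refine Complex.differentiableOn_tsum_of_summable_norm (hc (‖z‖ + 1)) (fun m => by fun_prop)
      Metric.isOpen_ball fun m w hw => ?_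
    rw [norm_mul, norm_pow]
    have : ‖w‖ ≤ ‖z‖ + 1 := by simpa using (Metric.mem_ball.1 hw).le
    gcongr
  exact this.differentiableAt (Metric.isOpen_ball.mem_nhds (by simp))

lemma differentiable_normBessel {ν : ℝ} (hν : -(1 / 2) ≤ ν) :
    Differentiable ℂ (normBessel ν) := by
  have : normBessel ν = fun z => ∑' m : ℕ, ((-1 : ℂ) ^ m * besselCoeff ν m) * z ^ (2 * m) :=
    funext fun z => normBessel_eq_tsum ν z
  rw [this]
  refine differentiable_tsum_even fun r => ?_
  have h := summable_besselCoeff hν r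
  refine h.congr fun m => ?_
  simp [abs_of_pos (besselCoeff_pos hν m)]

end GenFourier

/-! ### Phragmén–Lindelöf and Liouville arguments. -/

namespace GenFourier

/-- The Phragmén–Lindelöf principle in the first quadrant, in the borderline case of order two with
a majorant that is bounded on the imaginary axis. -/
lemma norm_le_of_quadrant_gaussian {Ψ : ℂ → ℂ} {K A : ℝ} (hK : 0 ≤ K) (hA : 0 ≤ A)
    (hd : DifferentiableOn ℂ Ψ {z | -1 < z.re})
    (h1 : ∀ z : ℂ, 0 ≤ z.re → 0 ≤ z.im → ‖Ψ z‖ ≤ K * Real.exp (A * z.re ^ 2))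
    (h2 : ∀ x : ℝ, 0 ≤ x → ‖Ψ x‖ ≤ K) {z : ℂ} (hre : 0 ≤ z.re) (him : 0 ≤ z.im) :
    ‖Ψ z‖ ≤ K := by
  rcases hre.eq_or_lt with hre0 | hre0
  · simpa [← hre0] using h1 z hre him
  have hz : z ≠ 0 := by rintro rfl; simp at hre0
  have hφ0 : 0 ≤ z.arg := Complex.arg_nonneg_iff.2 him
  have hφ1 : z.arg < Real.pi / 2 := (abs_lt.1 (Complex.abs_arg_lt_pi_div_two_iff.2 (Or.inl hre0))).2
  have key : ∀ θ ∈ Set.Ioo z.arg (Real.pi / 2),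
      ‖Ψ z‖ * Real.exp (-(A * Real.cos θ / (2 * Real.sin θ)) * (2 * z.re * z.im)) ≤ K := by
    intro θ hθ
    have hθ0 : 0 < θ := hφ0.trans_lt hθ.1
    have hsin : 0 < Real.sin θ := Real.sin_pos_of_pos_of_lt_pi hθ0 (by linarith [hθ.2, Real.pi_pos])
    have hcos : 0 < Real.cos θ := Real.cos_pos_of_mem_Ioo ⟨by linarith [Real.pi_pos], hθ.2⟩
    -- On the ray arg w = θ the factor |exp(iδw²)| = exp(-2δ Re w Im w) cancels exp(A (Re w)²)
    -- exactly for this δ; on the real axis it equals 1.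
    set δ : ℝ := A * Real.cos θ / (2 * Real.sin θ) with hδ
    have hδ0 : 0 ≤ δ := by positivity
    -- The exponential carries the strip 0 ≤ Im ζ ≤ θ to the sector 0 ≤ arg w ≤ θ.
    let F : ℂ → ℂ := fun ζ => Ψ (Complex.exp ζ) * Complex.exp (Complex.I * δ * Complex.exp ζ ^ 2)
    have hexpre : ∀ ζ : ℂ, 0 ≤ ζ.im → ζ.im ≤ θ → 0 ≤ (Complex.exp ζ).re ∧ 0 ≤ (Complex.exp ζ).im := by
      intro ζ h h'
      rw [Complex.exp_re, Complex.exp_im]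
      have := Real.cos_nonneg_of_mem_Icc (x := ζ.im) ⟨by linarith [Real.pi_pos], by linarith [hθ.2]⟩
      have := Real.sin_nonneg_of_nonneg_of_le_pi h (by linarith [hθ.2, Real.pi_pos])
      constructor <;> positivity
    have hnorm : ∀ w : ℂ, ‖Complex.exp (Complex.I * δ * w ^ 2)‖ =
        Real.exp (-δ * (2 * w.re * w.im)) := by
      intro w
      rw [Complex.norm_exp]
      congr 1
      simp only [pow_two, Complex.mul_re, Complex.mul_im, Complex.I_re, Complex.I_im,
        Complex.ofReal_re, Complex.ofReal_im]
      ring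
    have hFn : ∀ ζ, ‖F ζ‖ = ‖Ψ (Complex.exp ζ)‖ *
        Real.exp (-δ * (2 * (Complex.exp ζ).re * (Complex.exp ζ).im)) := by
      intro ζ
      rw [norm_mul, hnorm]
    have hdF : DiffContOnCl ℂ F (Complex.im ⁻¹' Set.Ioo 0 θ) := by
      apply DifferentiableOn.diffContOnCl
      have hcl : closure (Complex.im ⁻¹' Set.Ioo 0 θ) ⊆ Complex.im ⁻¹' Set.Icc 0 θ :=
        closure_minimal (Set.preimage_mono Set.Ioo_subset_Icc_self)
          (isClosed_Icc.preimage Complex.continuous_im)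
      refine DifferentiableOn.mono ?_ hcl
      refine DifferentiableOn.mul ?_ (by fun_prop)
      refine hd.comp (by fun_prop) fun ζ hζ => ?_
      have := (hexpre ζ hζ.1 hζ.2).1
      simp only [Set.mem_ofPred_eq]
      linarith
    have hmain := PhragmenLindelof.horizontal_strip (f := F) (C := K) (z := Complex.log z) hdF
      ⟨2, ?_, A, ?_⟩ ?_ ?_ (by rw [Complex.log_im]; exact hφ0)
      (by rw [Complex.log_im]; exact hθ.1.le)
    · rw [hFn, Complex.exp_log hz] at hmain
      exact hmain
    -- Order 2 is admissible in a sector of opening θ since θ < π/2; the full quadrant is the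
    -- excluded borderline.
    · rw [sub_zero, lt_div_iff₀ hθ0]
      linarith [hθ.2]
    · refine Asymptotics.IsBigO.of_bound K ?_
      rw [Filter.eventually_inf_principal]
      refine Filter.Eventually.of_forall fun ζ hζ => ?_
      obtain ⟨e1, e2⟩ := hexpre ζ hζ.1.le hζ.2.le
      rw [hFn, Real.norm_of_nonneg (Real.exp_pos _).le]
      have i1 : Real.exp (-δ * (2 * (Complex.exp ζ).re * (Complex.exp ζ).im)) ≤ 1 := by
        rw [Real.exp_le_one_iff]
        have : 0 ≤ δ * (2 * (Complex.exp ζ).re * (Complex.exp ζ).im) := by positivity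
        linarith
      have i2 : (Complex.exp ζ).re ^ 2 ≤ Real.exp (2 * |ζ.re|) := by
        have : (Complex.exp ζ).re ≤ Real.exp |ζ.re| := by
          refine (Complex.re_le_norm _).trans ?_
          rw [Complex.norm_exp]
          exact Real.exp_le_exp.2 (le_abs_self _)
        calc (Complex.exp ζ).re ^ 2 ≤ Real.exp |ζ.re| ^ 2 := by gcongr
          _ = _ := by rw [← Real.exp_nat_mul]; norm_num
      calc _ ≤ (K * Real.exp (A * (Complex.exp ζ).re ^ 2)) * 1 := by
            gcongr
            exact h1 _ e1 e2
        _ ≤ _ := by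
            rw [mul_one]
            gcongr
    · intro ζ hζ
      obtain ⟨e1, e2⟩ := hexpre ζ hζ.ge (by rw [hζ]; exact hθ0.le)
      have him0 : (Complex.exp ζ).im = 0 := by rw [Complex.exp_im, hζ]; simp
      have : Complex.exp ζ = ((Complex.exp ζ).re : ℂ) := by
        apply Complex.ext <;> simp [him0]
      rw [hFn, him0, mul_zero, mul_zero, Real.exp_zero, mul_one, this]
      exact h2 _ e1
    · intro ζ hζ
      obtain ⟨e1, e2⟩ := hexpre ζ (by rw [hζ]; exact hθ0.le) hζ.le
      rw [hFn]
      calc _ ≤ K * Real.exp (A * (Complex.exp ζ).re ^ 2) *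
            Real.exp (-δ * (2 * (Complex.exp ζ).re * (Complex.exp ζ).im)) := by
            gcongr
            exact h1 _ e1 e2
        _ = K := by
            rw [mul_assoc, ← Real.exp_add, Complex.exp_re, Complex.exp_im, hζ, hδ]
            have : A * (Real.exp ζ.re * Real.cos θ) ^ 2 + -(A * Real.cos θ / (2 * Real.sin θ)) *
                (2 * (Real.exp ζ.re * Real.cos θ) * (Real.exp ζ.re * Real.sin θ)) = 0 := by
              field_simp
              ring
            rw [this, Real.exp_zero, mul_one]
  -- Let θ → π/2: then δ → 0 and the auxiliary factor disappears.
  have hcont : ContinuousAt (fun θ : ℝ =>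
      ‖Ψ z‖ * Real.exp (-(A * Real.cos θ / (2 * Real.sin θ)) * (2 * z.re * z.im)))
      (Real.pi / 2) := by
    have : 2 * Real.sin (Real.pi / 2) ≠ 0 := by simp
    fun_prop (disch := assumption)
  have hlim := hcont.tendsto.mono_left (nhdsWithin_le_nhds (s := Set.Iio (Real.pi / 2)))
  simp only [Real.cos_pi_div_two, mul_zero, zero_div, neg_zero, zero_mul, Real.exp_zero,
    mul_one] at hlim
  exact le_of_tendsto hlim (Filter.mem_of_superset (Ioo_mem_nhdsLT hφ1) key)

/-- Polynomial factors are removed by dividing by (w + 1)^M, which has no zero in the region. The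
constant 2^M comes from 1 + |w| ≤ 2|w + 1| for Re w ≥ 0. -/
lemma norm_le_of_quadrant {Φ : ℂ → ℂ} (hΦ : Differentiable ℂ Φ) {C A : ℝ} {M : ℕ} (hC : 0 ≤ C)
    (hA : 0 ≤ A) (h1 : ∀ z, ‖Φ z‖ ≤ C * (1 + ‖z‖) ^ M * Real.exp (A * z.re ^ 2))
    (h2 : ∀ x : ℝ, 0 ≤ x → ‖Φ x‖ ≤ C * (1 + x) ^ M) {z : ℂ} (hre : 0 ≤ z.re) (him : 0 ≤ z.im) :
    ‖Φ z‖ ≤ C * 2 ^ M * (1 + ‖z‖) ^ M := by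
  have hne : ∀ w : ℂ, -1 < w.re → w + 1 ≠ 0 := by
    intro w hw h
    have := congrArg Complex.re h
    simp at this
    linarith
  have hlow : ∀ w : ℂ, 0 ≤ w.re → 1 + ‖w‖ ≤ 2 * ‖w + 1‖ := by
    intro w hw
    have h1 : 1 ≤ ‖w + 1‖ := by
      refine le_trans ?_ (Complex.re_le_norm _)
      simp [hw]
    have h2 : ‖w‖ ≤ ‖w + 1‖ := by
      rw [Complex.norm_def, Complex.norm_def]
      apply Real.sqrt_le_sqrt
      simp only [Complex.normSq_apply, Complex.add_re, Complex.add_im, Complex.one_re,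
        Complex.one_im]
      nlinarith
    linarith
  have key := norm_le_of_quadrant_gaussian (Ψ := fun w => Φ w / (w + 1) ^ M) (K := C * 2 ^ M)
    (A := A) (by positivity) hA
    (hΦ.differentiableOn.div (by fun_prop) fun w hw => pow_ne_zero _ (hne w hw)) ?_ ?_ hre him
  · have hpos : 0 < ‖z + 1‖ := norm_pos_iff.2 (hne z (by linarith))
    rw [norm_div, norm_pow, div_le_iff₀ (by positivity)] at key
    refine key.trans ?_
    have : ‖z + 1‖ ≤ 1 + ‖z‖ := by
      simpa [add_comm] using norm_add_le z 1
    gcongr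
  · intro w hw _
    have hpos : 0 < ‖w + 1‖ := norm_pos_iff.2 (hne w (by linarith))
    rw [norm_div, norm_pow, div_le_iff₀ (by positivity)]
    calc ‖Φ w‖ ≤ C * (1 + ‖w‖) ^ M * Real.exp (A * w.re ^ 2) := h1 w
      _ ≤ C * (2 * ‖w + 1‖) ^ M * Real.exp (A * w.re ^ 2) := by
          gcongr
          exact hlow w hw
      _ = _ := by rw [mul_pow]; ring
  · intro x hx
    have hpos : 0 < ‖(x : ℂ) + 1‖ := norm_pos_iff.2 (hne x (by simp; linarith))
    rw [norm_div, norm_pow, div_le_iff₀ (by positivity)]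
    calc ‖Φ x‖ ≤ C * (1 + x) ^ M := h2 x hx
      _ ≤ C * (2 * ‖(x : ℂ) + 1‖) ^ M := by
          gcongr
          simpa [abs_of_nonneg hx] using hlow x (by simpa using hx)
      _ = _ := by rw [mul_pow]; ring

/-- An entire function of polynomial growth is a polynomial. -/
lemma exists_polynomial_of_polynomial_growth {Φ : ℂ → ℂ} (hΦ : Differentiable ℂ Φ) {K : ℝ} {M : ℕ}
    (hK : 0 ≤ K) (h : ∀ z, ‖Φ z‖ ≤ K * (1 + ‖z‖) ^ M) :
    ∃ P : Polynomial ℂ, ∀ z, Φ z = P.eval z := by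
  have hzero : ∀ m, M < m → iteratedDeriv m Φ 0 = 0 := by
    intro m hm
    -- Cauchy's estimate on the circle of radius R, for derivatives of order above the growth
    -- exponent.
    have hb : ∀ᶠ R : ℝ in Filter.atTop, ‖iteratedDeriv m Φ 0‖ ≤
        m.factorial * (K * 2 ^ M) * R⁻¹ := by
      filter_upwards [Filter.eventually_ge_atTop 1] with R hR
      have hR0 : 0 < R := by linarith
      have := Complex.norm_iteratedDeriv_le_of_forall_mem_sphere_norm_le (c := 0) (R := R)
        (C := K * (1 + R) ^ M) (f := Φ) m hR0 hΦ.diffContOnCl (fun z hz => by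
          have : ‖z‖ = R := by simpa using hz
          rw [← this]; exact h z)
      refine this.trans ?_
      rw [mul_div_assoc, mul_assoc]
      gcongr
      rw [div_le_iff₀ (by positivity)]
      calc K * (1 + R) ^ M ≤ K * (2 * R) ^ M := by gcongr; linarith
        _ = K * 2 ^ M * R ^ M := by rw [mul_pow]; ring
        _ ≤ K * 2 ^ M * R ^ (m - 1) := by
            gcongr
            omega
        _ = K * 2 ^ M * R⁻¹ * R ^ m := by
            obtain ⟨j, rfl⟩ : ∃ j, m = j + 1 := ⟨m - 1, by omega⟩
            simp only [Nat.add_sub_cancel, pow_succ]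
            field_simp
    have hlim : Filter.Tendsto (fun R : ℝ => m.factorial * (K * 2 ^ M) * R⁻¹) Filter.atTop
        (nhds 0) := by
      simpa using tendsto_inv_atTop_zero.const_mul (m.factorial * (K * 2 ^ M))
    have := ge_of_tendsto hlim hb
    simpa using this
  refine ⟨∑ m ∈ Finset.range (M + 1),
    Polynomial.C ((m.factorial : ℂ)⁻¹ * iteratedDeriv m Φ 0) * Polynomial.X ^ m, fun z => ?_⟩
  rw [← Complex.taylorSeries_eq_of_entire hΦ 0 z, tsum_eq_sum (s := Finset.range (M + 1)),
    Polynomial.eval_finsetSum]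
  · refine Finset.sum_congr rfl fun m _ => ?_
    simp only [sub_zero, smul_eq_mul, Polynomial.eval_mul, Polynomial.eval_C, Polynomial.eval_pow,
      Polynomial.eval_X]
    ring
  · intro m hm
    rw [hzero m (by simpa using hm)]
    simp

/-- An even entire function which is of at most Gaussian growth in the real direction and of
polynomial growth in the imaginary direction, and whose restriction to the real axis has integrals
of polynomial growth, is a polynomial. -/
theorem exists_polynomial_of_gaussian_growth {G : ℂ → ℂ} (hG : Differentiable ℂ G) {C A : ℝ} {M : ℕ}
    (hC : 0 ≤ C) (hA : 0 ≤ A) (heven : ∀ z, G (-z) = G z)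
    (h1 : ∀ z, ‖G z‖ ≤ C * (1 + ‖z‖) ^ M * Real.exp (A * z.re ^ 2))
    (h2 : ∀ S : ℝ, 1 ≤ S → ∫ s in (1 : ℝ)..S, ‖G s‖ ≤ C * (1 + S) ^ M) :
    ∃ P : Polynomial ℂ, ∀ z, G z = P.eval z := by
  -- The second term covers [0, 1] and the value of the primitive at 1, where the hypothesis on
  -- integrals over [1, S] says nothing.
  set C' := C + C * 2 ^ (M + 1) * Real.exp A with hC'
  have hCC' : C ≤ C' := le_add_of_nonneg_right (by positivity)
  have hC'0 : 0 ≤ C' := hC.trans hCC'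
  -- On the real axis only integrals of the function are controlled, so Phragmén–Lindelöf is applied
  -- to a primitive, whose growth exponent is M + 1.
  have grow : ∀ {H Φ : ℂ → ℂ}, Φ 0 = 0 → (∀ z, HasDerivAt Φ (H z) z) → Differentiable ℂ H →
      (∀ z, ‖H z‖ ≤ C * (1 + ‖z‖) ^ M * Real.exp (A * z.re ^ 2)) →
      (∀ S : ℝ, 1 ≤ S → ∫ s in (1 : ℝ)..S, ‖H s‖ ≤ C * (1 + S) ^ M) →
      ∀ z, 0 ≤ z.re → 0 ≤ z.im → ‖Φ z‖ ≤ C' * 2 ^ (M + 1) * (1 + ‖z‖) ^ (M + 1) := by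
    intro H Φ h0 hd hHd hH1 hH2 z hre him
    have hb : ∀ z, ‖Φ z‖ ≤ C * (1 + ‖z‖) ^ (M + 1) * Real.exp (A * z.re ^ 2) := by
      intro z
      have := (convex_segment (𝕜 := ℝ) (0 : ℂ) z).norm_image_sub_le_of_norm_hasDerivWithin_le
        (f := Φ) (f' := H) (C := C * (1 + ‖z‖) ^ M * Real.exp (A * z.re ^ 2))
        (fun w _ => (hd w).hasDerivWithinAt) (fun w hw => ?_) (left_mem_segment ℝ 0 z)
        (right_mem_segment ℝ 0 z)
      · rw [h0, sub_zero, sub_zero] at this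
        refine this.trans ?_
        calc C * (1 + ‖z‖) ^ M * Real.exp (A * z.re ^ 2) * ‖z‖ ≤
            C * (1 + ‖z‖) ^ M * Real.exp (A * z.re ^ 2) * (1 + ‖z‖) := by gcongr; linarith
          _ = _ := by ring
      · rw [segment_eq_image] at hw
        obtain ⟨t, ⟨ht0, ht1⟩, rfl⟩ := hw
        refine (hH1 _).trans ?_
        simp only [smul_zero, zero_add, Complex.real_smul, norm_mul, Complex.norm_real,
          Real.norm_eq_abs, abs_of_nonneg ht0, Complex.re_ofReal_mul]
        have e1 : t * ‖z‖ ≤ ‖z‖ := mul_le_of_le_one_left (norm_nonneg _) ht1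
        have e2 : (t * z.re) ^ 2 ≤ z.re ^ 2 := by
          rw [mul_pow]
          exact mul_le_of_le_one_left (sq_nonneg _) (pow_le_one₀ ht0 ht1)
        gcongr
    have hΦd : Differentiable ℂ Φ := fun z => (hd z).differentiableAt
    refine norm_le_of_quadrant hΦd hC'0 hA (fun z => (hb z).trans (by gcongr)) ?_ hre him
    intro x hx
    rcases le_total x 1 with hx1 | hx1
    · refine (hb x).trans ?_
      simp only [Complex.norm_real, Real.norm_eq_abs, abs_of_nonneg hx, Complex.ofReal_re]
      have e1 : Real.exp (A * x ^ 2) ≤ Real.exp A :=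
        Real.exp_le_exp.2 (mul_le_of_le_one_right hA (pow_le_one₀ hx hx1))
      calc C * (1 + x) ^ (M + 1) * Real.exp (A * x ^ 2)
          ≤ C * (1 + x) ^ (M + 1) * Real.exp A := by gcongr
        _ = (C * Real.exp A) * (1 + x) ^ (M + 1) := by ring
        _ ≤ C' * (1 + x) ^ (M + 1) := by
            gcongr
            rw [hC']
            have : 1 ≤ (2 : ℝ) ^ (M + 1) := one_le_pow₀ (by norm_num)
            have h3 : C * Real.exp A * 1 ≤ C * Real.exp A * 2 ^ (M + 1) := by gcongr
            linarith
    · have hint : ∫ s in (1 : ℝ)..x, H s = Φ x - Φ (1 : ℝ) := by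
        refine intervalIntegral.integral_eq_sub_of_hasDerivAt (f := fun s : ℝ => Φ s)
          (fun s _ => (hd s).comp_ofReal) ?_
        exact (hHd.continuous.comp Complex.continuous_ofReal).intervalIntegrable _ _
      have e1 : ‖Φ x - Φ (1 : ℝ)‖ ≤ C * (1 + x) ^ M := by
        rw [← hint]
        exact (intervalIntegral.norm_integral_le_integral_norm hx1).trans (hH2 x hx1)
      have e2 : ‖Φ (1 : ℝ)‖ ≤ C * 2 ^ (M + 1) * Real.exp A := by
        refine (hb _).trans_eq ?_
        norm_num
      have e3 : ‖Φ x‖ ≤ C * (1 + x) ^ M + C * 2 ^ (M + 1) * Real.exp A := by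
        calc ‖Φ x‖ = ‖(Φ x - Φ (1 : ℝ)) + Φ (1 : ℝ)‖ := by rw [sub_add_cancel]
          _ ≤ _ := (norm_add_le _ _).trans (add_le_add e1 e2)
      have e4 : (1 + x) ^ M ≤ (1 + x) ^ (M + 1) := pow_le_pow_right₀ (by linarith) (by omega)
      have e5 : 1 ≤ (1 + x) ^ (M + 1) := one_le_pow₀ (by linarith)
      calc ‖Φ x‖ ≤ C * (1 + x) ^ M + C * 2 ^ (M + 1) * Real.exp A := e3
        _ ≤ C * (1 + x) ^ (M + 1) + C * 2 ^ (M + 1) * Real.exp A * (1 + x) ^ (M + 1) := by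
            have := mul_le_mul_of_nonneg_left e5
              (by positivity : 0 ≤ C * 2 ^ (M + 1) * Real.exp A)
            have := mul_le_mul_of_nonneg_left e4 hC
            linarith
        _ = _ := by rw [hC']; ring
  obtain ⟨Φ, hΦ0, hΦ⟩ := hG.isExactOn_univ.with_val_at 0 0
  have hΦ : ∀ z, HasDerivAt Φ (G z) z := fun z => hΦ z (Set.mem_univ z)
  have half : ∀ {Φ : ℂ → ℂ}, Φ 0 = 0 → (∀ z, HasDerivAt Φ (G z) z) →
      ∀ z, 0 ≤ z.re → ‖Φ z‖ ≤ C' * 2 ^ (M + 1) * (1 + ‖z‖) ^ (M + 1) := by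
    intro Φ hΦ0 hΦ z hre
    rcases le_total 0 z.im with him | him
    · exact grow hΦ0 hΦ hG h1 h2 z hre him
    -- The fourth quadrant reduces to the first by z ↦ conj(Φ(conj z)).
    · have := grow (H := fun z => starRingEnd ℂ (G (starRingEnd ℂ z)))
        (Φ := fun z => starRingEnd ℂ (Φ (starRingEnd ℂ z))) (by simp [hΦ0])
        (fun z => by
          have := (hΦ (starRingEnd ℂ z)).conj_conj
          simpa [Function.comp_def] using this)
        (fun z => (hG (starRingEnd ℂ z)).conj_conj.congr_of_eventuallyEq (by rfl) |> fun h => by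
          simpa [Function.comp_def] using h)
        (fun z => by simpa using h1 (starRingEnd ℂ z)) (by simpa using h2)
        (starRingEnd ℂ z) (by simpa using hre) (by simpa using him)
      simpa using this
  obtain ⟨P, hP⟩ := exists_polynomial_of_polynomial_growth (Φ := Φ)
    (fun z => (hΦ z).differentiableAt) (K := C' * 2 ^ (M + 1)) (M := M + 1) (by positivity)
    (fun z => by
      rcases le_total 0 z.re with hre | hre
      · exact half hΦ0 hΦ z hre
      -- Since G is even, -Φ(-z) is again a primitive of G vanishing at 0.
      · have := half (Φ := fun z => -Φ (-z)) (by simp [hΦ0]) (fun z => by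
          have := ((hΦ (-z)).scomp z (hasDerivAt_neg z)).neg
          exact this.congr_deriv (by simp [heven])) (-z) (by simpa using hre)
        simpa using this)
  refine ⟨P.derivative, fun z => ?_⟩
  have h3 := P.hasDerivAt z
  rw [← funext hP] at h3
  exact (hΦ z).unique h3

end GenFourier

/-! ### The weighted measure in the radial variable. -/

namespace GenFourier

lemma integrable_comp_abs_iff {E : Type*} [NormedAddCommGroup E] {f : ℝ → E} :
    Integrable (fun x => f |x|) ↔ IntegrableOn f (Set.Ioi 0) := by
  have h0 : IntegrableOn (fun x => f |x|) (Set.Ioi 0) ↔ IntegrableOn f (Set.Ioi 0) :=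
    integrableOn_congr_fun (fun x hx => by simp only [abs_of_pos (Set.mem_Ioi.1 hx)])
      measurableSet_Ioi
  rw [← h0]
  refine ⟨fun h => h.integrableOn, fun h => ?_⟩
  have h1 : IntegrableOn (fun x => f |x|) (Set.Iic 0) := by
    rw [← Measure.map_neg_eq_self (volume : Measure ℝ)]
    let m : MeasurableEmbedding fun x : ℝ => -x := (Homeomorph.neg ℝ).measurableEmbedding
    rw [m.integrableOn_map_iff]
    simp_rw [Function.comp_def, abs_neg, Set.neg_preimage, Set.neg_Iic, neg_zero]
    exact Iff.mpr integrableOn_Ici_iff_integrableOn_Ioi h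
  rw [← integrableOn_univ, ← Set.Iic_union_Ioi (a := (0 : ℝ))]
  exact h1.union h

/-- The radial variable `|x| ^ (1 / n)`. -/
noncomputable def root (n : ℕ) (x : ℝ) : ℝ := |x| ^ (1 / (n : ℝ))

@[simp] lemma root_nonneg (n : ℕ) (x : ℝ) : 0 ≤ root n x := Real.rpow_nonneg (abs_nonneg x) _

@[simp] lemma root_neg (n : ℕ) (x : ℝ) : root n (-x) = root n x := by simp [root]

lemma root_pow {n : ℕ} (hn : 0 < n) (x : ℝ) : root n x ^ n = |x| := by
  rw [root, one_div, Real.rpow_inv_natCast_pow (abs_nonneg x) hn.ne']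

lemma root_pow_of_nonneg {n : ℕ} (hn : 0 < n) {s : ℝ} (hs : 0 ≤ s) : root n (s ^ n) = s := by
  rw [root, one_div, abs_of_nonneg (by positivity), Real.pow_rpow_inv_natCast hs hn.ne']

lemma rpow_two_div (n : ℕ) (x : ℝ) : |x| ^ (2 / (n : ℝ)) = root n x ^ 2 := by
  rw [root, ← Real.rpow_natCast, ← Real.rpow_mul (abs_nonneg x)]
  congr 1
  push_cast
  ring

lemma root_mul (n : ℕ) (x y : ℝ) : root n (x * y) = root n x * root n y := by
  rw [root, abs_mul, Real.mul_rpow (abs_nonneg x) (abs_nonneg y)]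
  rfl

lemma continuous_root (n : ℕ) : Continuous (root n) :=
  continuous_abs.rpow_const fun _ => Or.inr (by positivity)

@[fun_prop] lemma measurable_root (n : ℕ) : Measurable (root n) := (continuous_root n).measurable

/-- The lower bound on k is exactly the condition α ≥ -1/2 under which Poisson's representation
holds. -/
lemma neg_half_le_index {n : ℕ} (hn : 0 < n) {k : ℝ} (hk : ((n : ℝ) - 1) / (2 * n) ≤ k) :
    -(1 / 2) ≤ index k n := by
  have hn' : (0 : ℝ) < n := by exact_mod_cast hn
  rw [div_le_iff₀ (by positivity)] at hk
  unfold index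
  linarith

/-- The exponent of the weight. -/
noncomputable def weightExponent (k : ℝ) (n : ℕ) : ℝ := 2 * k + 2 / (n : ℝ) - 2

/-- The normalizing constant of the weight. -/
noncomputable def weightConst (k : ℝ) (n : ℕ) : ℝ :=
  1 / (2 * Real.Gamma (index k n + 1)) * ((n : ℝ) / 2) ^ index k n

variable {n : ℕ} {k : ℝ}

lemma weightConst_pos (hn : 0 < n) (hα : -(1 / 2) ≤ index k n) : 0 < weightConst k n := by
  have hn' : (0 : ℝ) < n := by exact_mod_cast hn
  have : 0 < Real.Gamma (index k n + 1) := Real.Gamma_pos_of_pos (by linarith)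
  unfold weightConst
  positivity

lemma weightExponent_add_one_mul (hn : 0 < n) :
    (weightExponent k n + 1) * n = 2 * index k n + 2 := by
  have hn' : (0 : ℝ) < n := by exact_mod_cast hn
  unfold weightExponent index
  field_simp
  ring

lemma neg_one_lt_weightExponent (hn : 0 < n) (hα : -(1 / 2) ≤ index k n) :
    -1 < weightExponent k n := by
  have hn' : (0 : ℝ) < n := by exact_mod_cast hn
  have h := weightExponent_add_one_mul (k := k) hn
  have : 0 < (weightExponent k n + 1) * n := by rw [h]; linarith
  have := pos_of_mul_pos_left this hn'.le
  linarith

lemma weightedMeasure_eq (k : ℝ) (n : ℕ) : weightedMeasure k n =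
    (volume : Measure ℝ).withDensity fun x =>
      ENNReal.ofReal (weightConst k n * |x| ^ weightExponent k n) := rfl

lemma weight_nonneg (hn : 0 < n) (hα : -(1 / 2) ≤ index k n) (x : ℝ) :
    0 ≤ weightConst k n * |x| ^ weightExponent k n :=
  mul_nonneg (weightConst_pos hn hα).le (Real.rpow_nonneg (abs_nonneg x) _)

lemma measurable_weight (k : ℝ) (n : ℕ) :
    Measurable fun x : ℝ => weightConst k n * |x| ^ weightExponent k n := by
  fun_prop

lemma weightedMeasure_ac (k : ℝ) (n : ℕ) : weightedMeasure k n ≪ volume :=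
  withDensity_absolutelyContinuous _ _

/-- The density is positive off the origin, so almost everywhere statements transfer back to
Lebesgue measure. -/
lemma ac_weightedMeasure (hn : 0 < n) (hα : -(1 / 2) ≤ index k n) :
    volume ≪ weightedMeasure k n := by
  rw [weightedMeasure_eq]
  refine withDensity_absolutelyContinuous' (measurable_weight k n).ennreal_ofReal.aemeasurable ?_
  have : ∀ᵐ x : ℝ, x ≠ 0 := by simp [ae_iff]
  filter_upwards [this] with x hx
  have : 0 < weightConst k n * |x| ^ weightExponent k n :=
    mul_pos (weightConst_pos hn hα) (Real.rpow_pos_of_pos (abs_pos.2 hx) _)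
  simpa using this

instance instIsNegInvariant (k : ℝ) (n : ℕ) : (weightedMeasure k n).IsNegInvariant where
  neg_eq_self := by
    ext s hs
    rw [Measure.neg, Measure.map_apply measurable_neg hs, weightedMeasure_eq,
      withDensity_apply _ (measurable_neg hs), withDensity_apply _ hs,
      ← lintegral_indicator (measurable_neg hs), ← lintegral_indicator hs,
      ← lintegral_neg_eq_self (s.indicator _)]
    refine lintegral_congr fun x => ?_
    simp only [Set.indicator, abs_neg]
    rfl

lemma integrable_weightedMeasure_iff (hn : 0 < n) (hα : -(1 / 2) ≤ index k n)
    {E : Type*} [NormedAddCommGroup E] [NormedSpace ℝ E] {g : ℝ → E} :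
    Integrable g (weightedMeasure k n) ↔
      Integrable fun x => (weightConst k n * |x| ^ weightExponent k n) • g x := by
  rw [weightedMeasure_eq, integrable_withDensity_iff_integrable_smul'
    (measurable_weight k n).ennreal_ofReal (ae_of_all _ fun _ => ENNReal.ofReal_lt_top)]
  simp_rw [ENNReal.toReal_ofReal (weight_nonneg hn hα _)]

lemma integral_weightedMeasure (hn : 0 < n) (hα : -(1 / 2) ≤ index k n)
    {E : Type*} [NormedAddCommGroup E] [NormedSpace ℝ E] (g : ℝ → E) :
    ∫ x, g x ∂(weightedMeasure k n) =
      ∫ x, (weightConst k n * |x| ^ weightExponent k n) • g x := by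
  rw [weightedMeasure_eq, integral_withDensity_eq_integral_toReal_smul
    (measurable_weight k n).ennreal_ofReal (ae_of_all _ fun _ => ENNReal.ofReal_lt_top)]
  simp_rw [ENNReal.toReal_ofReal (weight_nonneg hn hα _)]

lemma integrable_radial_iff (hn : 0 < n) (hα : -(1 / 2) ≤ index k n) {g : ℝ → ℝ} :
    Integrable (fun x => g |x|) (weightedMeasure k n) ↔
      IntegrableOn (fun x => x ^ weightExponent k n * g x) (Set.Ioi 0) := by
  rw [integrable_weightedMeasure_iff hn hα, integrable_comp_abs_iff
    (f := fun x => (weightConst k n * x ^ weightExponent k n) • g x)]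
  simp_rw [smul_eq_mul, mul_assoc]
  exact integrable_const_mul_iff (weightConst_pos hn hα).ne'.isUnit _

lemma integral_radial (hn : 0 < n) (hα : -(1 / 2) ≤ index k n) (g : ℝ → ℝ) :
    ∫ x, g |x| ∂(weightedMeasure k n) =
      2 * weightConst k n * ∫ x in Set.Ioi 0, x ^ weightExponent k n * g x := by
  rw [integral_weightedMeasure hn hα, integral_comp_abs
    (f := fun x => (weightConst k n * x ^ weightExponent k n) • g x)]
  simp_rw [smul_eq_mul, mul_assoc]
  rw [integral_const_mul]

/-- Integrability of radial functions in the variable `s = |x| ^ (1 / n)`. -/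
lemma integrable_root_iff (hn : 0 < n) (hα : -(1 / 2) ≤ index k n) {g : ℝ → ℝ} :
    Integrable (fun x => g (root n x)) (weightedMeasure k n) ↔
      IntegrableOn (fun s => s ^ (2 * index k n + 1) * g s) (Set.Ioi 0) := by
  have hn' : (n : ℝ) ≠ 0 := by exact_mod_cast hn.ne'
  have : (fun x => g (root n x)) = fun x => (fun y : ℝ => g (y ^ (1 / (n : ℝ)))) |x| := rfl
  -- Substituting x = s^n turns the weight into s^((γ+1)n-1) = s^(2α+1), γ being `weightExponent k
  -- n`.
  rw [this, integrable_radial_iff hn hα (g := fun y : ℝ => g (y ^ (1 / (n : ℝ)))),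
    ← integrableOn_Ioi_comp_rpow_iff' _ hn']
  refine integrableOn_congr_fun (fun s hs => ?_) measurableSet_Ioi
  have hs : 0 < s := hs
  simp only [smul_eq_mul]
  rw [← Real.rpow_mul hs.le, ← Real.rpow_mul hs.le, mul_one_div_cancel hn', Real.rpow_one,
    ← mul_assoc, ← Real.rpow_add hs]
  congr 2
  have := weightExponent_add_one_mul (k := k) hn
  linarith

/-- A power of the radial variable for which the weight is integrable at infinity. -/
lemma exists_integrable_one_add_root (hn : 0 < n) (hα : -(1 / 2) ≤ index k n) :
    ∃ K : ℕ, Integrable (fun x => ((1 + root n x) ^ K)⁻¹) (weightedMeasure k n) := by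
  obtain ⟨K, hK⟩ := exists_nat_gt (2 * index k n + 2)
  refine ⟨K, (integrable_root_iff hn hα (g := fun s => ((1 + s) ^ K)⁻¹)).2 ?_⟩
  have hγ : 0 ≤ 2 * index k n + 1 := by linarith
  have hmeas : Measurable fun s : ℝ => s ^ (2 * index k n + 1) * ((1 + s) ^ K)⁻¹ := by fun_prop
  rw [← Set.Ioc_union_Ioi_eq_Ioi zero_le_one]
  refine IntegrableOn.union ?_ ?_
  · refine Measure.integrableOn_of_bounded (M := 1) (by simp) hmeas.aestronglyMeasurable ?_
    refine ae_restrict_of_forall_mem measurableSet_Ioc fun s hs => ?_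
    have h1 : s ^ (2 * index k n + 1) ≤ 1 := Real.rpow_le_one hs.1.le hs.2 hγ
    have h2 : ((1 + s) ^ K)⁻¹ ≤ 1 := inv_le_one_of_one_le₀ (one_le_pow₀ (by linarith [hs.1]))
    have h3 : 0 ≤ s ^ (2 * index k n + 1) := Real.rpow_nonneg hs.1.le _
    have h4 : 0 ≤ ((1 + s) ^ K)⁻¹ := by have := hs.1; positivity
    rw [Real.norm_of_nonneg (by positivity)]
    exact mul_le_one₀ h1 h4 h2
  · refine Integrable.mono' (integrableOn_Ioi_rpow_of_lt
      (a := 2 * index k n + 1 - K) (by linarith) one_pos) hmeas.aestronglyMeasurable ?_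
    refine ae_restrict_of_forall_mem measurableSet_Ioi fun s hs => ?_
    have hs : 1 < s := hs
    have h0 : 0 < s := by linarith
    rw [Real.norm_of_nonneg (by positivity), Real.rpow_sub h0, Real.rpow_natCast, div_eq_mul_inv]
    gcongr
    linarith

/-- The radial density s^(2α+1) is not integrable at infinity. This is why nonzero constants lie in
no L^q with q < ∞. -/
lemma weightedMeasure_root_gt (hn : 0 < n) (hα : -(1 / 2) ≤ index k n) (R : ℝ) :
    weightedMeasure k n {x | R < root n x} = ∞ := by
  by_contra h
  have hS : MeasurableSet {x : ℝ | R < root n x} :=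
    measurableSet_lt measurable_const (measurable_root n)
  have h1 : Integrable (fun x => Set.indicator (Set.Ioi R) (fun _ => (1 : ℝ)) (root n x))
      (weightedMeasure k n) := by
    have : (fun x => Set.indicator (Set.Ioi R) (fun _ => (1 : ℝ)) (root n x)) =
        Set.indicator {x : ℝ | R < root n x} (fun _ => (1 : ℝ)) := by
      ext x; simp [Set.indicator]
    rw [this, integrable_indicator_iff hS]
    exact integrableOn_const h
  rw [integrable_root_iff hn hα] at h1
  have hpos : 0 < max R 1 := lt_max_of_lt_right one_pos
  have h2 := h1.mono_set (Set.Ioi_subset_Ioi hpos.le)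
  have h3 : IntegrableOn (fun s : ℝ => s ^ (2 * index k n + 1)) (Set.Ioi (max R 1)) := by
    refine h2.congr_fun (fun s hs => ?_) measurableSet_Ioi
    have : R < s := lt_of_le_of_lt (le_max_left _ _) hs
    simp [Set.indicator, this]
  rw [integrableOn_Ioi_rpow_iff hpos] at h3
  linarith

/-- The even moments of Gaussians. -/
lemma gaussian_moment (hn : 0 < n) (hα : -(1 / 2) ≤ index k n) {c : ℝ} (hc : 0 < c) (m : ℕ) :
    Integrable (fun x => Real.exp (-(n * c * root n x ^ 2)) * root n x ^ (2 * m))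
        (weightedMeasure k n) ∧
      ∫ x, Real.exp (-(n * c * root n x ^ 2)) * root n x ^ (2 * m) ∂(weightedMeasure k n) =
        (1 / (2 * c)) ^ (index k n + 1) * (Real.Gamma (index k n + m + 1) /
          (Real.Gamma (index k n + 1) * (n * c) ^ m)) := by
  have hn' : (0 : ℝ) < n := by exact_mod_cast hn
  have hp : (0 : ℝ) < 2 / n := by positivity
  have hγ := neg_one_lt_weightExponent hn hα
  have hexp := weightExponent_add_one_mul (k := k) hn
  have hq : -1 < 2 * m / n + weightExponent k n := by
    have : (0 : ℝ) ≤ 2 * m / n := by positivity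
    linarith
  set g : ℝ → ℝ := fun y => Real.exp (-(n * c * y ^ (2 / (n : ℝ)))) * y ^ (2 * m / (n : ℝ)) with hg
  have hfun : (fun x => Real.exp (-(n * c * root n x ^ 2)) * root n x ^ (2 * m)) =
      fun x => g |x| := by
    ext x
    rw [hg]
    simp only
    rw [rpow_two_div, root, ← Real.rpow_natCast _ (2 * m), ← Real.rpow_mul (abs_nonneg x)]
    congr 2
    push_cast
    ring
  have hcongr : ∀ x ∈ Set.Ioi (0 : ℝ), x ^ weightExponent k n * g x =
      x ^ (2 * m / n + weightExponent k n) * Real.exp (-(n * c) * x ^ (2 / (n : ℝ))) := by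
    intro x hx
    rw [Real.rpow_add hx, hg, neg_mul]
    ring
  rw [hfun, integrable_radial_iff hn hα, integral_radial hn hα,
    integrableOn_congr_fun hcongr measurableSet_Ioi, setIntegral_congr_fun measurableSet_Ioi hcongr]
  refine ⟨integrableOn_rpow_mul_exp_neg_mul_rpow hq hp (by positivity), ?_⟩
  rw [integral_rpow_mul_exp_neg_mul_rpow hp hq (by positivity)]
  have e1 : (2 * m / n + weightExponent k n + 1) / (2 / (n : ℝ)) = index k n + m + 1 := by
    have : weightExponent k n = (2 * index k n + 2) / n - 1 := by
      rw [← hexp]; field_simp; ring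
    rw [this]
    field_simp
    ring
  rw [neg_div, e1]
  have hΓ : 0 < Real.Gamma (index k n + 1) := Real.Gamma_pos_of_pos (by linarith)
  have hnc : 0 < n * c := by positivity
  rw [show -(index k n + m + 1) = -(index k n + 1) - (m : ℕ) by ring, Real.rpow_sub hnc,
    Real.rpow_natCast, Real.rpow_neg hnc.le]
  have e2 : ((n : ℝ) / 2) ^ index k n = (n / 2) ^ (index k n + 1) / (n / 2) := by
    rw [Real.rpow_add_one (by positivity)]
    field_simp
  have e3 : (1 / (2 * c)) ^ (index k n + 1) =
      ((n : ℝ) / 2) ^ (index k n + 1) / (n * c) ^ (index k n + 1) := by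
    rw [← Real.div_rpow (by positivity) hnc.le]
    congr 1
    field_simp
  rw [weightConst, e2, e3]
  have := Real.rpow_pos_of_pos hnc (index k n + 1)
  field_simp

/-- Hölder's inequality against an integrable weight bounded by one. -/
lemma integrable_mul_of_memLp {μ : Measure ℝ} {p : ℝ≥0∞} (hp : 1 ≤ p) {F : ℝ → ℂ}
    (hF : MemLp F p μ) {w : ℝ → ℝ} (hw : Integrable w μ) (hwm : Measurable w)
    (h0 : ∀ x, 0 ≤ w x) (h1 : ∀ x, w x ≤ 1) : Integrable (fun x => (w x : ℂ) * F x) μ := by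
  -- The measure w dμ is finite and, as w ≤ 1, dominated by μ; so L^p(μ) ⊆ L^p(w dμ) ⊆ L¹(w dμ).
  set ν := μ.withDensity fun x => ENNReal.ofReal (w x) with hν
  have hle : ν ≤ μ := by
    conv_rhs => rw [← withDensity_one (μ := μ)]
    exact withDensity_mono (ae_of_all _ fun x => by simpa using h1 x)
  have : IsFiniteMeasure ν := isFiniteMeasure_withDensity_ofReal hw.2
  have h := (hF.mono_measure hle).integrable hp
  rw [hν, integrable_withDensity_iff_integrable_smul' hwm.ennreal_ofReal
    (ae_of_all _ fun _ => ENNReal.ofReal_lt_top)] at h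
  simpa [ENNReal.toReal_ofReal (h0 _)] using h

end GenFourier

/-! ### Uniqueness by characteristic functions and power series. -/

namespace GenFourier

/-- A finite complex density is determined by its characteristic function (real case). -/
lemma ae_eq_zero_of_forall_integral_real {μ : Measure ℝ} {σ : ℝ → ℝ} (hσ : MeasurableEmbedding σ)
    {h : ℝ → ℝ} (hh : Integrable h μ)
    (h0 : ∀ ξ : ℝ, ∫ x, (h x : ℂ) * Complex.exp (ξ * σ x * Complex.I) ∂μ = 0) : h =ᵐ[μ] 0 := by
  -- The positive and negative parts of h define finite measures whose images under σ have the same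
  -- characteristic function; injectivity of σ brings the equality back.
  set P := μ.withDensity fun x => ENNReal.ofReal (h x) with hP
  set N := μ.withDensity fun x => ENNReal.ofReal (-h x) with hN
  have : IsFiniteMeasure P := isFiniteMeasure_withDensity_ofReal hh.2
  have : IsFiniteMeasure N := isFiniteMeasure_withDensity_ofReal hh.neg.2
  have hm1 : AEMeasurable (fun x => ENNReal.ofReal (h x)) μ := hh.1.aemeasurable.ennreal_ofReal
  have hm2 : AEMeasurable (fun x => ENNReal.ofReal (-h x)) μ :=
    hh.1.aemeasurable.neg.ennreal_ofReal
  have hfin : ∫⁻ x, ENNReal.ofReal (h x) ∂μ ≠ ∞ := by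
    have := measure_ne_top P Set.univ
    rwa [hP, withDensity_apply _ MeasurableSet.univ, setLIntegral_univ] at this
  have hint : ∀ {g : ℝ → ℝ}, Integrable g μ → ∀ ξ : ℝ,
      Integrable (fun x => (g x : ℂ) * Complex.exp (ξ * σ x * Complex.I)) μ := by
    intro g hg ξ
    have hσm := hσ.measurable
    refine hg.ofReal.mul_bdd (c := 1)
      (by fun_prop : Measurable _).aestronglyMeasurable (ae_of_all _ fun x => ?_)
    have := Complex.norm_exp_ofReal_mul_I (ξ * σ x)
    push_cast at this
    exact this.le
  have hmap : P.map σ = N.map σ := by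
    refine Measure.ext_of_charFun (funext fun ξ => ?_)
    rw [charFun_apply_real, charFun_apply_real, hσ.integral_map, hσ.integral_map, hP, hN,
      integral_withDensity_eq_integral_toReal_smul₀ hm1 (ae_of_all _ fun _ => ENNReal.ofReal_lt_top),
      integral_withDensity_eq_integral_toReal_smul₀ hm2 (ae_of_all _ fun _ => ENNReal.ofReal_lt_top),
      ← sub_eq_zero]
    simp only [ENNReal.toReal_ofReal', Complex.real_smul]
    rw [← integral_sub (hint hh.pos_part ξ) (hint hh.neg_part ξ), ← h0 ξ]
    refine integral_congr_ae (ae_of_all _ fun x => ?_)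
    simp only
    rw [← sub_mul, ← Complex.ofReal_sub]
    congr 2
    exact max_zero_sub_max_neg_zero_eq_self (h x)
  have hPN := hσ.map_injective hmap
  rw [hP, hN, withDensity_eq_iff hm1 hm2 hfin] at hPN
  filter_upwards [hPN] with x hx
  rcases le_total 0 (h x) with h1 | h1
  · rw [ENNReal.ofReal_of_nonpos (neg_nonpos.2 h1), ENNReal.ofReal_eq_zero] at hx
    exact le_antisymm hx h1
  · rw [ENNReal.ofReal_of_nonpos h1, eq_comm, ENNReal.ofReal_eq_zero] at hx
    exact le_antisymm h1 (neg_nonpos.1 hx)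

/-- A finite complex density is determined by its characteristic function. -/
lemma ae_eq_zero_of_forall_integral {μ : Measure ℝ} {σ : ℝ → ℝ} (hσ : MeasurableEmbedding σ)
    {h : ℝ → ℂ} (hh : Integrable h μ)
    (h0 : ∀ ξ : ℝ, ∫ x, h x * Complex.exp (ξ * σ x * Complex.I) ∂μ = 0) : h =ᵐ[μ] 0 := by
  have hσm := hσ.measurable
  have hint : ∀ {g : ℝ → ℂ}, Integrable g μ → ∀ ξ : ℝ,
      Integrable (fun x => g x * Complex.exp (ξ * σ x * Complex.I)) μ := by
    intro g hg ξ
    refine hg.mul_bdd (c := 1)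
      (by fun_prop : Measurable _).aestronglyMeasurable (ae_of_all _ fun x => ?_)
    have := Complex.norm_exp_ofReal_mul_I (ξ * σ x)
    push_cast at this
    exact this.le
  have hconj : Integrable (fun x => starRingEnd ℂ (h x)) μ :=
    (Complex.conjCLE : ℂ →L[ℝ] ℂ).integrable_comp hh
  have h1 : ∀ ξ : ℝ, ∫ x, starRingEnd ℂ (h x) * Complex.exp (ξ * σ x * Complex.I) ∂μ = 0 := by
    intro ξ
    have := congrArg (starRingEnd ℂ) (h0 (-ξ))
    rw [← integral_conj, map_zero] at this
    rw [← this]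
    refine integral_congr_ae (ae_of_all _ fun x => ?_)
    simp [← Complex.exp_conj]
  have hre : (fun x => (h x).re) =ᵐ[μ] 0 := by
    refine ae_eq_zero_of_forall_integral_real hσ hh.re fun ξ => ?_
    have := integral_add (hint hh ξ) (hint hconj ξ)
    rw [h0, h1, add_zero] at this
    rw [← mul_eq_zero_iff_left (two_ne_zero (α := ℂ)), ← integral_const_mul, ← this]
    refine integral_congr_ae (ae_of_all _ fun x => ?_)
    simp only
    rw [← add_mul, Complex.add_conj]
    push_cast
    simp [mul_assoc]
  have him : (fun x => (h x).im) =ᵐ[μ] 0 := by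
    refine ae_eq_zero_of_forall_integral_real hσ hh.im fun ξ => ?_
    have := integral_sub (hint hh ξ) (hint hconj ξ)
    rw [h0, h1, sub_zero] at this
    have h2I : (2 * Complex.I : ℂ) ≠ 0 := by simp
    rw [← mul_eq_zero_iff_left h2I, ← integral_const_mul, ← this]
    refine integral_congr_ae (ae_of_all _ fun x => ?_)
    simp only
    rw [← sub_mul, Complex.sub_conj]
    push_cast
    ring
  filter_upwards [hre, him] with x h1 h2
  exact Complex.ext h1 h2

/-- One integrable majorant for all finite sums of norms bounds the sum of the integrals of the
norms, which permits termwise integration. -/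
lemma hasSum_integral_of_sum_norm_le {μ : Measure ℝ} {F : ℕ → ℝ → ℂ} {B : ℝ → ℝ} {g : ℝ → ℂ}
    (hF : ∀ m, AEStronglyMeasurable (F m) μ) (hB : Integrable B μ)
    (hle : ∀ s : Finset ℕ, ∀ x, ∑ m ∈ s, ‖F m x‖ ≤ B x) (hg : ∀ x, HasSum (fun m => F m x) (g x)) :
    HasSum (fun m => ∫ x, F m x ∂μ) (∫ x, g x ∂μ) ∧ Summable fun m => ‖∫ x, F m x ∂μ‖ := by
  have hFi : ∀ m, Integrable (F m) μ := fun m =>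
    hB.mono' (hF m) (ae_of_all _ fun x => by simpa using hle {m} x)
  have hs : Summable fun m => ∫ x, ‖F m x‖ ∂μ := by
    refine summable_of_sum_le (c := ∫ x, B x ∂μ)
      (fun m => integral_nonneg fun x => norm_nonneg _) fun s => ?_
    rw [← integral_finsetSum _ fun m _ => (hFi m).norm]
    exact integral_mono (integrable_finsetSum _ fun m _ => (hFi m).norm) hB (hle s)
  refine ⟨?_, Summable.of_nonneg_of_le (fun _ => norm_nonneg _)
    (fun m => norm_integral_le_integral_norm _) hs⟩
  have := hasSum_integral_of_summable_integral_norm hFi hs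
  simpa only [fun x => (hg x).tsum_eq] using this

/-- Uniqueness of the coefficients of an even power series. -/
lemma coeff_eq_zero_of_hasSum_even {c : ℕ → ℂ}
    (h : ∀ z : ℂ, HasSum (fun m => c m * z ^ (2 * m)) 0) (m : ℕ) : c m = 0 := by
  have hp : HasFPowerSeriesAt (0 : ℂ → ℂ) (FormalMultilinearSeries.ofScalars ℂ c) 0 := by
    rw [hasFPowerSeriesAt_iff]
    refine Filter.Eventually.of_forall fun w => ?_
    obtain ⟨z, rfl⟩ : ∃ z : ℂ, z ^ 2 = w := IsSquare.exists_sq w (IsAlgClosed.exists_pow_nat_eq w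
      two_pos |>.imp fun z hz => by rw [← hz, sq]) |>.imp fun _ h => h.symm
    simp only [FormalMultilinearSeries.coeff_ofScalars, smul_eq_mul, Pi.zero_apply]
    refine hasSum_of_forall_eq (h z) fun m => ?_
    rw [pow_mul, mul_comm]
  rw [← FormalMultilinearSeries.coeff_ofScalars (𝕜 := ℂ) (p := c) (n := m), hp.eq_zero]
  rfl

/-- The signed root `sgn(x) |x| ^ (1 / n)`. -/
noncomputable def signedRoot (n : ℕ) (x : ℝ) : ℝ := if 0 ≤ x then root n x else -root n x

/-- Unlike |x|^(1/n), the signed root is injective, so characteristic functions taken along it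
determine a density on the whole line. -/
lemma measurableEmbedding_signedRoot {n : ℕ} (hn : 0 < n) : MeasurableEmbedding (signedRoot n) := by
  refine Measurable.measurableEmbedding ?_ fun x y hxy => ?_
  · exact Measurable.ite measurableSet_Ici (measurable_root n) (measurable_root n).neg
  · have habs : ∀ {x y : ℝ}, root n x = root n y → |x| = |y| := fun {x y} h => by
      rw [← root_pow hn, h, root_pow hn]
    have hz : ∀ {x : ℝ}, root n x = 0 → x = 0 := fun {x} h => by
      rw [← abs_eq_zero, ← root_pow hn, h, zero_pow hn.ne']
    unfold signedRoot at hxy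
    split_ifs at hxy with h1 h2 h2
    · have := habs hxy
      rwa [abs_of_nonneg h1, abs_of_nonneg h2] at this
    · have e1 := root_nonneg n x
      have e2 := root_nonneg n y
      rw [hz (by linarith : root n x = 0), hz (by linarith : root n y = 0)]
    · have e1 := root_nonneg n x
      have e2 := root_nonneg n y
      rw [hz (by linarith : root n x = 0), hz (by linarith : root n y = 0)]
    · have := habs (neg_injective hxy)
      rw [abs_of_neg (not_le.1 h1), abs_of_neg (not_le.1 h2)] at this
      linarith

lemma abs_signedRoot (n : ℕ) (x : ℝ) : |signedRoot n x| = root n x := by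
  unfold signedRoot
  split_ifs <;> simp

lemma signedRoot_neg {n : ℕ} (hn : 0 < n) (x : ℝ) : signedRoot n (-x) = -signedRoot n x := by
  unfold signedRoot
  rcases lt_trichotomy x 0 with h | h | h
  · rw [if_pos (by linarith), if_neg (by linarith), root_neg, neg_neg]
  · have : root n 0 = 0 := by
      have := root_pow hn 0
      rw [abs_zero] at this
      exact eq_zero_of_pow_eq_zero this
    simp [h, this]
  · rw [if_neg (by linarith), if_pos h.le, root_neg]

/-! ### Bessel transforms of functions of Gaussian decay. -/

variable {n : ℕ} {k : ℝ}

/-- Integrability of `ρ` against `e ^ (n a |x| ^ (2 / n))`, up to a polynomial factor. -/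
def HasGaussianDecay (k : ℝ) (n : ℕ) (a : ℝ) (M : ℕ) (ρ : ℝ → ℂ) : Prop :=
  Integrable (fun x => ((Real.exp (n * a * root n x ^ 2) / (1 + root n x) ^ M : ℝ) : ℂ) * ρ x)
    (weightedMeasure k n)

/-- The Bessel transform of `ρ`, as a function of a complex radial variable. -/
noncomputable def besselTransform (k : ℝ) (n : ℕ) (ν : ℝ) (ρ : ℝ → ℂ) (z : ℂ) : ℂ :=
  ∫ x, ρ x * normBessel ν (n * z * root n x) ∂(weightedMeasure k n)

namespace HasGaussianDecay

variable {a : ℝ} {M : ℕ} {ρ : ℝ → ℂ}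

lemma aestronglyMeasurable (h : HasGaussianDecay k n a M ρ) :
    AEStronglyMeasurable ρ (weightedMeasure k n) := by
  have hm : Measurable fun x => ((Real.exp (n * a * root n x ^ 2) / (1 + root n x) ^ M : ℝ) : ℂ)⁻¹ := by
    fun_prop
  refine (hm.aestronglyMeasurable.mul h.1).congr (ae_of_all _ fun x => ?_)
  have : ((Real.exp (n * a * root n x ^ 2) / (1 + root n x) ^ M : ℝ) : ℂ) ≠ 0 := by
    have := root_nonneg n x
    rw [Complex.ofReal_ne_zero]
    positivity
  simp only [Pi.mul_apply]
  rw [inv_mul_cancel_left₀ this]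

lemma integrable_norm (h : HasGaussianDecay k n a M ρ) :
    Integrable (fun x => Real.exp (n * a * root n x ^ 2) / (1 + root n x) ^ M * ‖ρ x‖)
      (weightedMeasure k n) := by
  refine h.norm.congr (ae_of_all _ fun x => ?_)
  have := root_nonneg n x
  simp only
  rw [norm_mul, Complex.norm_real, Real.norm_of_nonneg (by positivity)]

end HasGaussianDecay

/-- Completing the square, ht = h²/(4a) + at² - a(t - h/(2a))². The negative square pays for moving
the polynomial loss from t to h. -/
lemma exists_exp_bound (hn : 0 < n) {a : ℝ} (ha : 0 < a) (M : ℕ) : ∃ C : ℝ, 0 ≤ C ∧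
    ∀ h t : ℝ, 0 ≤ h → 0 ≤ t → Real.exp (n * h * t) ≤
      C * (1 + h) ^ M * Real.exp (n * h ^ 2 / (4 * a)) *
        (Real.exp (n * a * t ^ 2) / (1 + t) ^ M) := by
  have hn' : (0 : ℝ) < n := by exact_mod_cast hn
  set β : ℝ := n * a with hβ
  have hβ0 : 0 < β := by positivity
  -- From (1+u)^M ≤ M! e^(1+u) and u ≤ βu² + 1/(4β).
  set C1 : ℝ := M.factorial * Real.exp (1 + 1 / (4 * β)) with hC1
  have h1 : ∀ u : ℝ, 0 ≤ u → (1 + u) ^ M ≤ C1 * Real.exp (β * u ^ 2) := by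
    intro u hu
    have e1 := Real.pow_div_factorial_le_exp (x := 1 + u) (by linarith) M
    rw [div_le_iff₀ (by positivity)] at e1
    refine e1.trans ?_
    rw [hC1, mul_assoc, ← Real.exp_add, mul_comm]
    refine mul_le_mul_of_nonneg_left (Real.exp_le_exp.2 ?_) (by positivity)
    have : 0 ≤ (2 * β * u - 1) ^ 2 / (4 * β) := by positivity
    have e : (2 * β * u - 1) ^ 2 / (4 * β) = β * u ^ 2 - u + 1 / (4 * β) := by
      field_simp; ring
    linarith
  set C2 : ℝ := 1 + 1 / (2 * a) with hC2
  refine ⟨C1 * C2 ^ M, by positivity, fun h t hh ht => ?_⟩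
  have e1 : 1 + t ≤ C2 * (1 + h) * (1 + |t - h / (2 * a)|) := by
    have i1 : t ≤ h / (2 * a) + |t - h / (2 * a)| := by linarith [le_abs_self (t - h / (2 * a))]
    have i2 : 1 + h / (2 * a) ≤ C2 * (1 + h) := by
      have : C2 * (1 + h) = 1 + h / (2 * a) + (h + 1 / (2 * a)) := by
        rw [hC2]; ring
      rw [this]
      have : 0 ≤ h + 1 / (2 * a) := by positivity
      linarith
    have i3 : 0 ≤ |t - h / (2 * a)| := abs_nonneg _
    have i4 : 0 ≤ h / (2 * a) := by positivity
    calc 1 + t ≤ (1 + h / (2 * a)) * (1 + |t - h / (2 * a)|) := by nlinarith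
      _ ≤ _ := by gcongr
  have e2 : (1 + t) ^ M ≤ (C2 * (1 + h)) ^ M * (C1 * Real.exp (β * (t - h / (2 * a)) ^ 2)) := by
    calc (1 + t) ^ M ≤ (C2 * (1 + h) * (1 + |t - h / (2 * a)|)) ^ M := by gcongr
      _ = (C2 * (1 + h)) ^ M * (1 + |t - h / (2 * a)|) ^ M := mul_pow _ _ _
      _ ≤ _ := by
          gcongr
          simpa [sq_abs] using h1 _ (abs_nonneg (t - h / (2 * a)))
  rw [← mul_div_assoc, le_div_iff₀ (by positivity)]
  calc Real.exp (n * h * t) * (1 + t) ^ M ≤ Real.exp (n * h * t) *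
        ((C2 * (1 + h)) ^ M * (C1 * Real.exp (β * (t - h / (2 * a)) ^ 2))) := by gcongr
    _ = C1 * C2 ^ M * (1 + h) ^ M *
        (Real.exp (n * h * t) * Real.exp (β * (t - h / (2 * a)) ^ 2)) := by
        rw [mul_pow]; ring
    _ = C1 * C2 ^ M * (1 + h) ^ M *
        (Real.exp (n * h ^ 2 / (4 * a)) * Real.exp (n * a * t ^ 2)) := by
        rw [← Real.exp_add, ← Real.exp_add]
        congr 2
        rw [hβ]
        field_simp
        ring
    _ = _ := by ring

namespace HasGaussianDecay

variable {a : ℝ} {M : ℕ} {ρ : ℝ → ℂ}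

lemma exists_integral_exp_le (hn : 0 < n) (ha : 0 < a) (hρ : HasGaussianDecay k n a M ρ) :
    ∃ C : ℝ, 0 ≤ C ∧ ∀ h : ℝ, 0 ≤ h →
      Integrable (fun x => Real.exp (n * h * root n x) * ‖ρ x‖) (weightedMeasure k n) ∧
      ∫ x, Real.exp (n * h * root n x) * ‖ρ x‖ ∂(weightedMeasure k n) ≤
        C * (1 + h) ^ M * Real.exp (n * h ^ 2 / (4 * a)) := by
  obtain ⟨C, hC, hb⟩ := exists_exp_bound hn ha M
  have hI := hρ.integrable_norm
  refine ⟨C * ∫ x, Real.exp (n * a * root n x ^ 2) / (1 + root n x) ^ M * ‖ρ x‖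
    ∂(weightedMeasure k n), ?_, fun h hh => ?_⟩
  · refine mul_nonneg hC (integral_nonneg fun x => ?_)
    have := root_nonneg n x
    simp only [Pi.zero_apply]
    positivity
  · have hle : ∀ x, Real.exp (n * h * root n x) * ‖ρ x‖ ≤
        C * (1 + h) ^ M * Real.exp (n * h ^ 2 / (4 * a)) *
          (Real.exp (n * a * root n x ^ 2) / (1 + root n x) ^ M * ‖ρ x‖) := by
      intro x
      rw [← mul_assoc]
      exact mul_le_mul_of_nonneg_right (hb h _ hh (root_nonneg n x)) (norm_nonneg _)
    have hi : Integrable (fun x => Real.exp (n * h * root n x) * ‖ρ x‖) (weightedMeasure k n) := by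
      refine (hI.const_mul (C * (1 + h) ^ M * Real.exp (n * h ^ 2 / (4 * a)))).mono' ?_
        (ae_of_all _ fun x => ?_)
      · exact (by fun_prop : Measurable fun x =>
          Real.exp (n * h * root n x)).aestronglyMeasurable.mul hρ.aestronglyMeasurable.norm
      · rw [Real.norm_of_nonneg (by positivity)]
        exact hle x
    refine ⟨hi, (integral_mono hi (hI.const_mul _) hle).trans_eq ?_⟩
    rw [integral_const_mul]
    ring

lemma integrable_exp (hn : 0 < n) (ha : 0 < a) (hρ : HasGaussianDecay k n a M ρ) {h : ℝ}
    (hh : 0 ≤ h) : Integrable (fun x => Real.exp (n * h * root n x) * ‖ρ x‖)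
      (weightedMeasure k n) :=
  let ⟨_, _, h'⟩ := hρ.exists_integral_exp_le hn ha
  (h' h hh).1

lemma integrable (hn : 0 < n) (ha : 0 < a) (hρ : HasGaussianDecay k n a M ρ) :
    Integrable ρ (weightedMeasure k n) := by
  rw [← integrable_norm_iff hρ.aestronglyMeasurable]
  simpa using hρ.integrable_exp hn ha le_rfl

variable {ν : ℝ}

/-- The power series of the Bessel transform. -/
lemma hasSum_besselTransform (hn : 0 < n) (ha : 0 < a) (hρ : HasGaussianDecay k n a M ρ)
    (hν : -(1 / 2) ≤ ν) (z : ℂ) :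
    HasSum (fun m : ℕ => ((-1 : ℂ) ^ m * besselCoeff ν m * n ^ (2 * m) *
      ∫ x, ρ x * root n x ^ (2 * m) ∂(weightedMeasure k n)) * z ^ (2 * m))
      (besselTransform k n ν ρ z) ∧
    Summable (fun m : ℕ => ‖(-1 : ℂ) ^ m * besselCoeff ν m * n ^ (2 * m) *
      ∫ x, ρ x * root n x ^ (2 * m) ∂(weightedMeasure k n)‖ * ‖z‖ ^ (2 * m)) := by
  have hF : ∀ m : ℕ, AEStronglyMeasurable (fun x => ρ x * ((-1 : ℂ) ^ m * besselCoeff ν m *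
      (n * z * root n x) ^ (2 * m))) (weightedMeasure k n) := fun m =>
    hρ.aestronglyMeasurable.mul (by fun_prop : Measurable _).aestronglyMeasurable
  have main := hasSum_integral_of_sum_norm_le (μ := weightedMeasure k n)
    (F := fun m x => ρ x * ((-1 : ℂ) ^ m * besselCoeff ν m * (n * z * root n x) ^ (2 * m)))
    (B := fun x => Real.exp (n * ‖z‖ * root n x) * ‖ρ x‖)
    (g := fun x => ρ x * normBessel ν (n * z * root n x)) hF
    (hρ.integrable_exp hn ha (norm_nonneg z)) (fun s x => ?_)
    (fun x => (hasSum_normBessel hν _).mul_left _)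
  · have hcoef : ∀ m : ℕ, ∫ x, ρ x * ((-1 : ℂ) ^ m * besselCoeff ν m *
        (n * z * root n x) ^ (2 * m)) ∂(weightedMeasure k n) =
        ((-1 : ℂ) ^ m * besselCoeff ν m * n ^ (2 * m) *
          ∫ x, ρ x * root n x ^ (2 * m) ∂(weightedMeasure k n)) * z ^ (2 * m) := by
      intro m
      rw [mul_assoc _ (∫ x, ρ x * root n x ^ (2 * m) ∂(weightedMeasure k n)),
        mul_comm (∫ x, ρ x * root n x ^ (2 * m) ∂(weightedMeasure k n)),
        ← mul_assoc, ← integral_const_mul]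
      congr 1
      ext x
      rw [mul_pow, mul_pow]
      ring
    simp_rw [hcoef] at main
    refine ⟨main.1, ?_⟩
    simpa only [norm_mul, norm_pow] using main.2
  · simp only [norm_mul (ρ x), norm_besselTerm hν]
    rw [← Finset.mul_sum, mul_comm]
    have hnorm : ‖(n * z * root n x : ℂ)‖ = n * ‖z‖ * root n x := by
      simp [abs_of_nonneg (root_nonneg n x)]
    gcongr
    rw [hnorm]
    have h0 : 0 ≤ n * ‖z‖ * root n x := by
      have := root_nonneg n x
      positivity
    refine le_trans ((summable_besselCoeff hν _).sum_le_tsum s fun m _ => ?_)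
      (tsum_besselCoeff_le hν h0)
    have := (besselCoeff_pos hν m).le
    positivity

lemma differentiable_besselTransform (hn : 0 < n) (ha : 0 < a) (hρ : HasGaussianDecay k n a M ρ)
    (hν : -(1 / 2) ≤ ν) : Differentiable ℂ (besselTransform k n ν ρ) := by
  have : besselTransform k n ν ρ = fun z => ∑' m : ℕ, ((-1 : ℂ) ^ m * besselCoeff ν m *
      n ^ (2 * m) * ∫ x, ρ x * root n x ^ (2 * m) ∂(weightedMeasure k n)) * z ^ (2 * m) :=
    funext fun z => (hρ.hasSum_besselTransform hn ha hν z).1.tsum_eq.symm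
  rw [this]
  refine differentiable_tsum_even fun r => ?_
  have := (hρ.hasSum_besselTransform hn ha hν (r : ℂ)).2
  simpa [pow_mul, sq_abs] using this

lemma integrable_mul_normBessel (hn : 0 < n) (ha : 0 < a) (hρ : HasGaussianDecay k n a M ρ)
    (hν : -(1 / 2) ≤ ν) (z : ℂ) :
    Integrable (fun x => ρ x * normBessel ν (n * z * root n x)) (weightedMeasure k n) ∧
    ‖besselTransform k n ν ρ z‖ ≤
      ∫ x, Real.exp (n * |z.im| * root n x) * ‖ρ x‖ ∂(weightedMeasure k n) := by
  have hi := hρ.integrable_exp hn ha (abs_nonneg z.im)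
  have hle : ∀ x, ‖ρ x * normBessel ν (n * z * root n x)‖ ≤
      Real.exp (n * |z.im| * root n x) * ‖ρ x‖ := by
    intro x
    rw [norm_mul, mul_comm]
    gcongr
    refine (norm_normBessel_le hν _).trans_eq ?_
    congr 1
    simp [abs_mul, abs_of_nonneg (root_nonneg n x)]
  refine ⟨hi.mono' ?_ (ae_of_all _ hle), norm_integral_le_of_norm_le hi (ae_of_all _ hle)⟩
  exact hρ.aestronglyMeasurable.mul ((differentiable_normBessel hν).continuous.measurable.comp
    (by fun_prop : Measurable fun x => (n * z * root n x : ℂ))).aestronglyMeasurable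

/-- The growth of the Bessel transform of a function of Gaussian decay. -/
lemma exists_norm_besselTransform_le (hn : 0 < n) (ha : 0 < a) (hρ : HasGaussianDecay k n a M ρ)
    (hν : -(1 / 2) ≤ ν) : ∃ C : ℝ, 0 ≤ C ∧ ∀ z : ℂ, ‖besselTransform k n ν ρ z‖ ≤
      C * (1 + ‖z‖) ^ M * Real.exp (n * z.im ^ 2 / (4 * a)) := by
  obtain ⟨C, hC, h⟩ := hρ.exists_integral_exp_le hn ha
  refine ⟨C, hC, fun z => ?_⟩
  refine (hρ.integrable_mul_normBessel hn ha hν z).2.trans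
    (((h _ (abs_nonneg z.im)).2).trans ?_)
  rw [sq_abs]
  gcongr
  exact Complex.abs_im_le_norm z

lemma even_besselTransform (hn : 0 < n) (ha : 0 < a) (hρ : HasGaussianDecay k n a M ρ)
    (hν : -(1 / 2) ≤ ν) (z : ℂ) :
    besselTransform k n ν ρ (-z) = besselTransform k n ν ρ z := by
  refine (hρ.hasSum_besselTransform hn ha hν (-z)).1.unique ?_
  refine hasSum_of_forall_eq (hρ.hasSum_besselTransform hn ha hν z).1 fun m => ?_
  rw [Even.neg_pow (even_two_mul m)]

/-- The Bessel transform determines the even part of a function of Gaussian decay. -/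
lemma add_neg_eq_zero_of_besselTransform_eq_zero (hn : 0 < n) (ha : 0 < a)
    (hρ : HasGaussianDecay k n a M ρ) (hν : -(1 / 2) ≤ ν)
    (h0 : ∀ z, besselTransform k n ν ρ z = 0) :
    ∀ᵐ x ∂(weightedMeasure k n), ρ x + ρ (-x) = 0 := by
  have hn' : (n : ℂ) ≠ 0 := by exact_mod_cast hn.ne'
  -- The power series of the transform is zero and no `besselCoeff` vanishes, so all even moments of
  -- ρ are zero.
  have hmom : ∀ m : ℕ, ∫ x, ρ x * root n x ^ (2 * m) ∂(weightedMeasure k n) = 0 := by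
    intro m
    have := coeff_eq_zero_of_hasSum_even (fun z => by
      have := (hρ.hasSum_besselTransform hn ha hν z).1
      rwa [h0 z] at this) m
    have hc : (besselCoeff ν m : ℂ) ≠ 0 := by exact_mod_cast (besselCoeff_pos hν m).ne'
    simpa [hc, hn'] using this
  have hρi := hρ.integrable hn ha
  have hρn : Integrable (fun x => ρ (-x)) (weightedMeasure k n) := hρi.comp_neg
  set e : ℝ → ℂ := fun x => ρ x + ρ (-x) with he
  have hei : Integrable e (weightedMeasure k n) := hρi.add hρn
  have hσm := (measurableEmbedding_signedRoot hn).measurable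
  have hexp : ∀ h : ℝ, 0 ≤ h →
      Integrable (fun x => Real.exp (n * h * root n x) * ‖e x‖) (weightedMeasure k n) := by
    intro h hh
    have h1 := hρ.integrable_exp hn ha hh
    have h2 := h1.comp_neg
    refine (h1.add h2).mono' ?_ (ae_of_all _ fun x => ?_)
    · exact (by fun_prop : Measurable fun x =>
        Real.exp (n * h * root n x)).aestronglyMeasurable.mul hei.1.norm
    · rw [Real.norm_of_nonneg (by positivity)]
      simp only [Pi.add_apply, root_neg]
      rw [← mul_add]
      gcongr
      exact norm_add_le _ _
  have hpow : ∀ j : ℕ, Integrable (fun x => e x * (signedRoot n x : ℂ) ^ j) (weightedMeasure k n) := by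
    intro j
    refine ((hexp 1 zero_le_one).const_mul (j.factorial : ℝ)).mono' ?_ (ae_of_all _ fun x => ?_)
    · exact hei.1.mul (by fun_prop : Measurable _).aestronglyMeasurable
    · have h1 := Real.pow_div_factorial_le_exp (x := root n x) (root_nonneg n x) j
      rw [div_le_iff₀ (by positivity)] at h1
      rw [norm_mul, norm_pow, Complex.norm_real, Real.norm_eq_abs, abs_signedRoot]
      have h2 : Real.exp (root n x) ≤ Real.exp (n * 1 * root n x) := by
        apply Real.exp_le_exp.2
        have : (1 : ℝ) ≤ n := by exact_mod_cast hn
        nlinarith [root_nonneg n x]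
      calc ‖e x‖ * root n x ^ j ≤ ‖e x‖ * (Real.exp (n * 1 * root n x) * j.factorial) := by
            gcongr
            exact h1.trans (by gcongr)
        _ = _ := by ring
  -- Even moments of e are twice those of ρ; odd ones vanish because e is even and the signed root
  -- is odd.
  have hmom' : ∀ j : ℕ, ∫ x, e x * (signedRoot n x : ℂ) ^ j ∂(weightedMeasure k n) = 0 := by
    intro j
    rcases Nat.even_or_odd j with hj | hj
    · obtain ⟨m, rfl⟩ := hj.two_dvd
      have hsq : ∀ x, (signedRoot n x : ℂ) ^ (2 * m) = (root n x : ℂ) ^ (2 * m) := by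
        intro x
        rw [pow_mul, pow_mul, ← Complex.ofReal_pow, ← sq_abs, abs_signedRoot, Complex.ofReal_pow]
      have hi : Integrable (fun x => ρ x * (root n x : ℂ) ^ (2 * m)) (weightedMeasure k n) := by
        refine ((hρ.integrable_exp hn ha zero_le_one).const_mul ((2 * m).factorial : ℝ)).mono' ?_
          (ae_of_all _ fun x => ?_)
        · exact hρ.aestronglyMeasurable.mul (by fun_prop : Measurable _).aestronglyMeasurable
        · have h1 := Real.pow_div_factorial_le_exp (x := root n x) (root_nonneg n x) (2 * m)
          rw [div_le_iff₀ (by positivity)] at h1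
          rw [norm_mul, norm_pow, Complex.norm_real, Real.norm_of_nonneg (root_nonneg n x)]
          have h2 : Real.exp (root n x) ≤ Real.exp (n * 1 * root n x) := by
            apply Real.exp_le_exp.2
            have : (1 : ℝ) ≤ n := by exact_mod_cast hn
            nlinarith [root_nonneg n x]
          calc ‖ρ x‖ * root n x ^ (2 * m) ≤
              ‖ρ x‖ * (Real.exp (n * 1 * root n x) * (2 * m).factorial) := by
                gcongr
                exact h1.trans (by gcongr)
            _ = _ := by ring
      have h2 := integral_add hi hi.comp_neg
      rw [integral_neg_eq_self (fun x => ρ x * (root n x : ℂ) ^ (2 * m)), hmom m, add_zero] at h2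
      rw [← h2]
      congr 1
      ext x
      rw [hsq, he]
      simp only [root_neg]
      ring
    · have h1 := integral_neg_eq_self (fun x => e x * (signedRoot n x : ℂ) ^ j)
        (weightedMeasure k n)
      have h2 : ∀ x, e (-x) * (signedRoot n (-x) : ℂ) ^ j = -(e x * (signedRoot n x : ℂ) ^ j) := by
        intro x
        rw [signedRoot_neg hn, Complex.ofReal_neg, hj.neg_pow, he]
        simp only [neg_neg]
        ring
      simp_rw [h2] at h1
      rw [integral_neg] at h1
      exact self_eq_neg.1 h1.symm
  refine ae_eq_zero_of_forall_integral (measurableEmbedding_signedRoot hn) hei fun ξ => ?_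
  -- Exponential integrability of e lets the characteristic function be expanded in these vanishing
  -- moments.
  have main := hasSum_integral_of_sum_norm_le (μ := weightedMeasure k n)
    (F := fun j x => e x * ((ξ * signedRoot n x * Complex.I) ^ j / j.factorial))
    (B := fun x => Real.exp (n * |ξ| * root n x) * ‖e x‖)
    (g := fun x => e x * Complex.exp (ξ * signedRoot n x * Complex.I))
    (fun j => hei.1.mul (by fun_prop : Measurable _).aestronglyMeasurable)
    (hexp |ξ| (abs_nonneg ξ)) (fun s x => ?_) (fun x => ?_)
  · refine main.1.unique ?_
    have : ∀ j : ℕ, ∫ x, e x * ((ξ * signedRoot n x * Complex.I) ^ j / j.factorial)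
        ∂(weightedMeasure k n) = 0 := by
      intro j
      have : ∀ x, e x * ((ξ * signedRoot n x * Complex.I) ^ j / j.factorial) =
          ((ξ * Complex.I) ^ j / j.factorial) * (e x * (signedRoot n x : ℂ) ^ j) := by
        intro x
        rw [mul_right_comm, mul_pow]
        ring
      simp_rw [this]
      rw [integral_const_mul, hmom' j, mul_zero]
    simp_rw [this]
    exact hasSum_zero
  · simp only [norm_mul (e x), norm_div, norm_pow, norm_mul (_ * _ : ℂ), Complex.norm_I, mul_one,
      Complex.norm_natCast]
    rw [← Finset.mul_sum, mul_comm]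
    gcongr
    have hnorm : ‖(ξ * signedRoot n x : ℂ)‖ = |ξ| * root n x := by
      rw [norm_mul, Complex.norm_real, Complex.norm_real, Real.norm_eq_abs, Real.norm_eq_abs,
        abs_signedRoot]
    rw [hnorm]
    have h0 : 0 ≤ |ξ| * root n x := mul_nonneg (abs_nonneg _) (root_nonneg n x)
    have hs : HasSum (fun j : ℕ => (|ξ| * root n x) ^ j / j.factorial)
        (Real.exp (|ξ| * root n x)) := by
      rw [Real.exp_eq_exp_ℝ]
      exact NormedSpace.expSeries_div_hasSum_exp _
    calc _ ≤ Real.exp (|ξ| * root n x) :=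
          sum_le_hasSum s (fun j _ => by positivity) hs
      _ ≤ _ := by
          apply Real.exp_le_exp.2
          have : (1 : ℝ) ≤ n := by exact_mod_cast hn
          rw [mul_assoc]
          exact le_mul_of_one_le_left h0 this
  · refine HasSum.mul_left _ ?_
    rw [Complex.exp_eq_exp_ℂ]
    exact NormedSpace.expSeries_div_hasSum_exp _

end HasGaussianDecay

end GenFourier

/-! ### Critical decay forces a polynomial times a Gaussian. -/

namespace GenFourier

variable {n : ℕ} {k : ℝ}

lemma exists_norm_eval_ge {Q : Polynomial ℂ} (hQ : 0 < Q.degree) (B : ℝ) :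
    ∃ R : ℝ, ∀ s : ℝ, R < s → B ≤ ‖Q.eval (s : ℂ)‖ := by
  have hz : Filter.Tendsto (fun s : ℝ => ‖(s : ℂ)‖) Filter.atTop Filter.atTop := by
    simpa using Filter.tendsto_abs_atTop_atTop
  obtain ⟨R, hR⟩ := Filter.eventually_atTop.1
    ((Q.tendsto_norm_atTop hQ hz).eventually_ge_atTop B)
  exact ⟨R, fun s hs => hR s hs.le⟩

lemma not_memLp_of_le_norm (hn : 0 < n) (hα : -(1 / 2) ≤ index k n) {q : ℝ≥0∞} (hq0 : q ≠ 0)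
    (hq : q ≠ ∞) {H : ℝ → ℂ} {c R : ℝ} (hc : 0 < c) (h : ∀ x, R < root n x → c ≤ ‖H x‖) :
    ¬ MemLp H q (weightedMeasure k n) := by
  intro hm
  have h1 := hm.meas_ge_lt_top hq0 hq (ε := ⟨c, hc.le⟩) (by
    intro h0
    exact hc.ne' (congrArg NNReal.toReal h0))
  refine (ne_of_lt h1) (top_unique ?_)
  rw [← weightedMeasure_root_gt hn hα R]
  exact measure_mono fun x hx => h x hx

/-- A polynomial in the radial variable that lies in `L ^ q`, `q < ∞`, vanishes. -/
lemma polynomial_eq_zero_of_memLp (hn : 0 < n) (hα : -(1 / 2) ≤ index k n) {q : ℝ≥0∞}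
    (hq0 : q ≠ 0) (hq : q ≠ ∞) {Q : Polynomial ℂ}
    (hQ : MemLp (fun x => Q.eval (root n x : ℂ)) q (weightedMeasure k n)) : Q = 0 := by
  by_contra h0
  rcases lt_or_ge 0 Q.degree with hd | hd
  · obtain ⟨R, hR⟩ := exists_norm_eval_ge hd 1
    exact not_memLp_of_le_norm hn hα hq0 hq one_pos (fun x hx => hR _ hx) hQ
  · rw [Polynomial.eq_C_of_degree_le_zero hd] at hQ h0
    simp only [Polynomial.eval_C] at hQ
    have hc : 0 < ‖Q.coeff 0‖ := norm_pos_iff.2 fun h => h0 (by rw [h, Polynomial.C_0])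
    exact not_memLp_of_le_norm hn hα hq0 hq hc (R := 0) (fun x _ => le_rfl) hQ

/-- A polynomial in the radial variable that lies in some `L ^ q` is constant. -/
lemma polynomial_degree_le_zero_of_memLp (hn : 0 < n) (hα : -(1 / 2) ≤ index k n) {q : ℝ≥0∞}
    (hq0 : q ≠ 0) {Q : Polynomial ℂ}
    (hQ : MemLp (fun x => Q.eval (root n x : ℂ)) q (weightedMeasure k n)) : Q.degree ≤ 0 := by
  by_cases hq : q = ∞
  · subst hq
    by_contra! hd
    have hfin := hQ.2
    rw [eLpNorm_exponent_top] at hfin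
    set B := eLpNormEssSup (fun x => Q.eval (root n x : ℂ)) (weightedMeasure k n) with hB
    obtain ⟨R, hR⟩ := exists_norm_eval_ge hd (B.toReal + 1)
    have h1 : ∀ᵐ x ∂(weightedMeasure k n), ¬ (R < root n x) := by
      filter_upwards [ae_le_eLpNormEssSup (f := fun x => Q.eval (root n x : ℂ))
        (μ := weightedMeasure k n)] with x hx hlt
      have h2 := ENNReal.toReal_mono hfin.ne hx
      rw [toReal_enorm] at h2
      have h3 := hR _ hlt
      linarith
    rw [ae_iff] at h1
    simp only [not_not] at h1
    rw [weightedMeasure_root_gt hn hα R] at h1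
    exact ENNReal.top_ne_zero h1
  · rw [polynomial_eq_zero_of_memLp hn hα hq0 hq hQ]
    simp

namespace HasGaussianDecay

variable {a : ℝ} {M : ℕ} {ρ : ℝ → ℂ} {ν : ℝ}

/-- If the Bessel transform of a function of Gaussian decay has critical Gaussian decay in a weak
sense, then it is a polynomial times a Gaussian. -/
theorem exists_polynomial (hn : 0 < n) (hα : -(1 / 2) ≤ index k n) (ha : 0 < a)
    (hρ : HasGaussianDecay k n a M ρ) (hν : -(1 / 2) ≤ ν) {b : ℝ} (hab : 1 / (4 * a) ≤ b)
    {q : ℝ≥0∞} (hq : 1 ≤ q) (N : ℕ)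
    (hL : MemLp (fun x => ((Real.exp (n * b * root n x ^ 2) * root n x ^ N : ℝ) : ℂ) *
      besselTransform k n ν ρ (root n x)) q (weightedMeasure k n)) :
    ∃ P : Polynomial ℂ,
      (∀ z, besselTransform k n ν ρ z = P.eval z * Complex.exp (-(n * z ^ 2 / (4 * a)))) ∧
      MemLp (fun x => (Polynomial.X ^ N * P).eval (root n x : ℂ)) q (weightedMeasure k n) := by
  have hn' : (0 : ℝ) < n := by exact_mod_cast hn
  set G : ℂ → ℂ := fun z => Complex.exp (n * z ^ 2 / (4 * a)) * besselTransform k n ν ρ z with hG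
  have hGd : Differentiable ℂ G :=
    (by fun_prop : Differentiable ℂ fun z : ℂ => Complex.exp (n * z ^ 2 / (4 * a))).mul
      (hρ.differentiable_besselTransform hn ha hν)
  have hexp : ∀ z : ℂ, ‖Complex.exp (n * z ^ 2 / (4 * a))‖ =
      Real.exp (n * (z.re ^ 2 - z.im ^ 2) / (4 * a)) := by
    intro z
    rw [Complex.norm_exp]
    congr 1
    have : (n * z ^ 2 / (4 * a) : ℂ) = ((n / (4 * a) : ℝ) : ℂ) * z ^ 2 := by
      push_cast; ring
    rw [this, Complex.re_ofReal_mul, sq z, Complex.mul_re]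
    ring
  have hGm : Measurable fun x => ((root n x ^ N : ℝ) : ℂ) * G (root n x) := by
    have := hGd.continuous.measurable
    fun_prop
  -- Here b ≥ 1/(4a) enters: on the real axis exp(ns²/(4a)) ≤ exp(nbs²).
  have hH : MemLp (fun x => ((root n x ^ N : ℝ) : ℂ) * G (root n x)) q (weightedMeasure k n) := by
    refine hL.mono hGm.aestronglyMeasurable (ae_of_all _ fun x => ?_)
    rw [hG, norm_mul, norm_mul, norm_mul, hexp, Complex.norm_real, Complex.norm_real,
      norm_mul, Real.norm_of_nonneg (Real.exp_pos _).le, ← mul_assoc, mul_comm ‖root n x ^ N‖]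
    gcongr
    simp only [Complex.ofReal_re, Complex.ofReal_im]
    have : 0 ≤ n * root n x ^ 2 := by positivity
    calc n * (root n x ^ 2 - 0 ^ 2) / (4 * a) = 1 / (4 * a) * (n * root n x ^ 2) := by ring
      _ ≤ b * (n * root n x ^ 2) := by gcongr
      _ = _ := by ring
  obtain ⟨C, hC, hCb⟩ := hρ.exists_norm_besselTransform_le hn ha hν
  obtain ⟨K, hK⟩ := exists_integrable_one_add_root (k := k) hn hα
  -- The weight (1+s)^(-K) trades L^q for L¹, whatever q is; this raises the growth exponent from M
  -- to M + K.
  have hw := integrable_mul_of_memLp hq hH hK (by fun_prop)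
    (fun x => by have := root_nonneg n x; positivity)
    (fun x => inv_le_one_of_one_le₀ (one_le_pow₀ (by have := root_nonneg n x; linarith)))
  have hw2 : Integrable (fun x => (fun s : ℝ => ((1 + s) ^ K)⁻¹ * (|s| ^ N * ‖G s‖)) (root n x))
      (weightedMeasure k n) := by
    refine hw.norm.congr (ae_of_all _ fun x => ?_)
    have := root_nonneg n x
    simp only [norm_mul, Complex.norm_real, norm_inv, norm_pow, Real.norm_eq_abs]
    rw [abs_of_nonneg (by positivity : 0 ≤ 1 + root n x)]
  have hw3 : IntegrableOn (fun s : ℝ => s ^ (2 * index k n + 1) *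
      (((1 + s) ^ K)⁻¹ * (|s| ^ N * ‖G s‖))) (Set.Ioi 0) :=
    (integrable_root_iff hn hα (g := fun s : ℝ => ((1 + s) ^ K)⁻¹ * (|s| ^ N * ‖G s‖))).1 hw2
  set J := ∫ s in Set.Ioi (0 : ℝ), s ^ (2 * index k n + 1) *
    (((1 + s) ^ K)⁻¹ * (|s| ^ N * ‖G s‖)) with hJ
  have hnn : ∀ s ∈ Set.Ioi (0 : ℝ), 0 ≤ s ^ (2 * index k n + 1) *
      (((1 + s) ^ K)⁻¹ * (|s| ^ N * ‖G s‖)) := by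
    intro s hs
    have hs : 0 < s := hs
    positivity
  have hJ0 : 0 ≤ J := setIntegral_nonneg measurableSet_Ioi hnn
  obtain ⟨P, hP⟩ := exists_polynomial_of_gaussian_growth (G := G) (C := C + J) (A := n / (4 * a))
    (M := M + K) hGd (by positivity) (by positivity)
    (fun z => by simp only [hG, neg_sq, hρ.even_besselTransform hn ha hν z])
    (fun z => by
      rw [hG, norm_mul, hexp]
      calc Real.exp (n * (z.re ^ 2 - z.im ^ 2) / (4 * a)) * ‖besselTransform k n ν ρ z‖
          ≤ Real.exp (n * (z.re ^ 2 - z.im ^ 2) / (4 * a)) *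
            (C * (1 + ‖z‖) ^ M * Real.exp (n * z.im ^ 2 / (4 * a))) := by
            gcongr
            exact hCb z
        _ = C * (1 + ‖z‖) ^ M * (Real.exp (n * (z.re ^ 2 - z.im ^ 2) / (4 * a)) *
            Real.exp (n * z.im ^ 2 / (4 * a))) := by ring
        _ = C * (1 + ‖z‖) ^ M * Real.exp (n / (4 * a) * z.re ^ 2) := by
            rw [← Real.exp_add]
            congr 2
            ring
        _ ≤ (C + J) * (1 + ‖z‖) ^ (M + K) * Real.exp (n / (4 * a) * z.re ^ 2) := by
            gcongr
            · linarith
            · linarith [norm_nonneg z]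
            · omega)
    -- On [1, S] the factors s^(2α+1), s^N and ((1+S)/(1+s))^K are all at least 1, so they may be
    -- inserted to reach J.
    (fun S hS => by
      have hsub : Set.Ioc 1 S ⊆ Set.Ioi (0 : ℝ) := fun s hs => one_pos.trans hs.1
      have hI := hw3.mono_set hsub
      rw [intervalIntegral.integral_of_le hS]
      calc ∫ s in Set.Ioc 1 S, ‖G s‖ ≤ ∫ s in Set.Ioc 1 S, (1 + S) ^ K *
            (s ^ (2 * index k n + 1) * (((1 + s) ^ K)⁻¹ * (|s| ^ N * ‖G s‖))) := by
            refine setIntegral_mono_on ?_ (hI.const_mul _) measurableSet_Ioc fun s hs => ?_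
            · exact ((hGd.continuous.comp Complex.continuous_ofReal).norm.integrableOn_Icc).mono_set
                Set.Ioc_subset_Icc_self
            · have h1 : 1 ≤ s := hs.1.le
              have e1 : 1 ≤ s ^ (2 * index k n + 1) := Real.one_le_rpow h1 (by linarith)
              have e2 : 1 ≤ |s| ^ N := one_le_pow₀ (by rwa [abs_of_nonneg (by linarith)])
              have e3 : 1 ≤ (1 + S) ^ K * ((1 + s) ^ K)⁻¹ := by
                rw [← div_eq_mul_inv, one_le_div (by positivity)]
                have := hs.2
                gcongr
              have e4 : 1 ≤ (1 + S) ^ K * ((1 + s) ^ K)⁻¹ * s ^ (2 * index k n + 1) * |s| ^ N :=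
                one_le_mul_of_one_le_of_one_le (one_le_mul_of_one_le_of_one_le e3 e1) e2
              calc ‖G s‖ = 1 * ‖G s‖ := (one_mul _).symm
                _ ≤ _ * ‖G s‖ := mul_le_mul_of_nonneg_right e4 (norm_nonneg _)
                _ = _ := by ring
        _ = (1 + S) ^ K * ∫ s in Set.Ioc 1 S, s ^ (2 * index k n + 1) *
            (((1 + s) ^ K)⁻¹ * (|s| ^ N * ‖G s‖)) := integral_const_mul _ _
        _ ≤ (1 + S) ^ K * J := by
            gcongr
            exact setIntegral_mono_set hw3 (ae_restrict_of_forall_mem measurableSet_Ioi hnn)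
              (Filter.Eventually.of_forall hsub)
        _ ≤ (C + J) * (1 + S) ^ (M + K) := by
            rw [mul_comm]
            gcongr
            · linarith
            · linarith
            · omega)
  refine ⟨P, fun z => ?_, ?_⟩
  · rw [← hP z, hG, mul_right_comm, ← Complex.exp_add, add_neg_cancel, Complex.exp_zero, one_mul]
  · refine hH.congr_norm (by fun_prop) (ae_of_all _ fun x => ?_)
    rw [hP, Polynomial.eval_mul, Polynomial.eval_pow, Polynomial.eval_X]
    push_cast
    rfl

end HasGaussianDecay

/-- The Gaussian `e ^ (- n c |x| ^ (2 / n))`. -/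
noncomputable def gaussian (n : ℕ) (c : ℝ) (x : ℝ) : ℂ := (Real.exp (-(n * c * root n x ^ 2)) : ℝ)

@[fun_prop] lemma measurable_gaussian (n : ℕ) (c : ℝ) : Measurable (gaussian n c) := by
  unfold gaussian
  fun_prop

/-- The rate is the Gaussian's own c: the exponentials cancel and only the integrable (1+s)^(-K)
remains. -/
lemma hasGaussianDecay_gaussian (hn : 0 < n) (hα : -(1 / 2) ≤ index k n) (c : ℝ) :
    ∃ K : ℕ, HasGaussianDecay k n c K (gaussian n c) := by
  obtain ⟨K, hK⟩ := exists_integrable_one_add_root (k := k) hn hα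
  refine ⟨K, hK.ofReal.congr (ae_of_all _ fun x => ?_)⟩
  simp only [gaussian]
  rw [← Complex.ofReal_mul, div_mul_eq_mul_div, ← Real.exp_add, add_neg_cancel, Real.exp_zero,
    one_div]
  rfl

/-- The Bessel transform of a Gaussian is a Gaussian. -/
lemma besselTransform_gaussian (hn : 0 < n) (hα : -(1 / 2) ≤ index k n) {c : ℝ} (hc : 0 < c)
    (z : ℂ) : besselTransform k n (index k n) (gaussian n c) z =
      ((1 / (2 * c)) ^ (index k n + 1) : ℝ) * Complex.exp (-(n * z ^ 2 / (4 * c))) := by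
  have hn' : (0 : ℝ) < n := by exact_mod_cast hn
  obtain ⟨K, hK⟩ := hasGaussianDecay_gaussian (k := k) hn hα c
  refine (hK.hasSum_besselTransform hn hc hα z).1.unique ?_
  have hexp : HasSum (fun m : ℕ => (-(n * z ^ 2 / (4 * c)) : ℂ) ^ m / m.factorial)
      (Complex.exp (-(n * z ^ 2 / (4 * c)))) := by
    rw [Complex.exp_eq_exp_ℂ]
    exact NormedSpace.expSeries_div_hasSum_exp _
  refine hasSum_of_forall_eq
    (hexp.mul_left (((1 / (2 * c)) ^ (index k n + 1) : ℝ) : ℂ)) fun m => ?_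
  have hint : ∫ x, gaussian n c x * (root n x : ℂ) ^ (2 * m) ∂(weightedMeasure k n) =
      ((1 / (2 * c)) ^ (index k n + 1) * (Real.Gamma (index k n + m + 1) /
          (Real.Gamma (index k n + 1) * (n * c) ^ m)) : ℝ) := by
    rw [← (gaussian_moment hn hα hc m).2, ← integral_complex_ofReal]
    congr 1
    ext x
    simp [gaussian]
  rw [hint, besselCoeff]
  have hc' : (c : ℂ) ≠ 0 := by exact_mod_cast hc.ne'
  have hn'' : (n : ℂ) ≠ 0 := by exact_mod_cast hn.ne'
  have h1 : (Real.Gamma (index k n + 1) : ℂ) ≠ 0 := by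
    exact_mod_cast (Real.Gamma_pos_of_pos (by linarith)).ne'
  have h2 : (Real.Gamma (index k n + m + 1) : ℂ) ≠ 0 := by
    have : (0 : ℝ) ≤ m := m.cast_nonneg
    exact_mod_cast (Real.Gamma_pos_of_pos (by linarith)).ne'
  have h3 : (m.factorial : ℂ) ≠ 0 := by exact_mod_cast m.factorial_ne_zero
  have h4 : ((4 : ℂ) ^ m) ≠ 0 := pow_ne_zero _ (by norm_num)
  rw [neg_pow (n * z ^ 2 / (4 * c) : ℂ), div_pow, mul_pow, mul_pow, ← pow_mul z, pow_mul (n : ℂ) 2]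
  push_cast
  rw [mul_pow (4 : ℂ)]
  field_simp
  ring

/-! ### Splitting the transform into even and odd parts. -/

variable {f : ℝ → ℂ} {a : ℝ} {M : ℕ}

/-- Multiplication by x costs n powers of the radial variable, as |x| = s^n. -/
lemma HasGaussianDecay.id_mul (hn : 0 < n) (hf : HasGaussianDecay k n a M f) :
    HasGaussianDecay k n a (M + n) fun x => (x : ℂ) * f x := by
  have hm := hf.aestronglyMeasurable
  refine Integrable.mono hf ?_ (ae_of_all _ fun x => ?_)
  · exact (by fun_prop : Measurable _).aestronglyMeasurable.mul
      ((by fun_prop : Measurable _).aestronglyMeasurable.mul hm)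
  · have h0 := root_nonneg n x
    rw [← mul_assoc, norm_mul, norm_mul, norm_mul, Complex.norm_real, Complex.norm_real,
      Complex.norm_real, Real.norm_eq_abs x, ← root_pow hn x, Real.norm_of_nonneg (by positivity),
      Real.norm_of_nonneg (by positivity)]
    refine mul_le_mul_of_nonneg_right ?_ (norm_nonneg _)
    rw [pow_add, div_mul_eq_mul_div, div_le_div_iff₀ (by positivity) (by positivity)]
    have : root n x ^ n ≤ (1 + root n x) ^ n := by
      gcongr
      linarith
    calc Real.exp (n * a * root n x ^ 2) * root n x ^ n * (1 + root n x) ^ M ≤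
        Real.exp (n * a * root n x ^ 2) * (1 + root n x) ^ n * (1 + root n x) ^ M := by gcongr
      _ = _ := by ring

/-- The constant in front of the odd part of the kernel. -/
noncomputable def oddConst (k : ℝ) (n : ℕ) : ℂ :=
  (-Complex.I) ^ n * ((n : ℂ) / 2) ^ n *
    ((Real.Gamma (index k n + 1) / Real.Gamma (index k n + n + 1) : ℝ) : ℂ)

lemma oddConst_ne_zero (hn : 0 < n) (hα : -(1 / 2) ≤ index k n) : oddConst k n ≠ 0 := by
  have hn' : (n : ℂ) ≠ 0 := by exact_mod_cast hn.ne'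
  have h1 : 0 < Real.Gamma (index k n + 1) := Real.Gamma_pos_of_pos (by linarith)
  have h2 : 0 < Real.Gamma (index k n + n + 1) := Real.Gamma_pos_of_pos (by
    have : (0 : ℝ) ≤ n := n.cast_nonneg
    linarith)
  have h3 : ((Real.Gamma (index k n + 1) / Real.Gamma (index k n + n + 1) : ℝ) : ℂ) ≠ 0 := by
    exact_mod_cast (div_pos h1 h2).ne'
  unfold oddConst
  simp [h3, hn', -Complex.ofReal_div]

/-- The generalized Fourier transform in terms of the Bessel transforms of the even and odd
parts. -/
lemma transform_eq (hn : 0 < n) (hα : -(1 / 2) ≤ index k n) (ha : 0 < a)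
    (hf : HasGaussianDecay k n a M f) (y : ℝ) :
    transform k n f y = besselTransform k n (index k n) f (root n y) +
      oddConst k n * y *
        besselTransform k n (index k n + n) (fun x => (x : ℂ) * f x) (root n y) := by
  have hα' : -(1 / 2) ≤ index k n + n := by
    have : (0 : ℝ) ≤ n := n.cast_nonneg
    linarith
  have h1 := (hf.integrable_mul_normBessel hn ha hα (root n y)).1
  have h2 := ((hf.id_mul hn).integrable_mul_normBessel hn ha hα' (root n y)).1
  unfold besselTransform transform
  rw [← integral_const_mul, ← integral_add h1 (h2.const_mul _)]
  congr 1
  ext x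
  have harg : (((n : ℝ) * |y * x| ^ (1 / (n : ℝ)) : ℝ) : ℂ) = n * root n y * root n x := by
    have := root_mul n y x
    rw [root] at this
    rw [this]
    push_cast
    ring
  rw [kernel, harg, oddConst]
  push_cast
  ring

end GenFourier

/-! ### The uniqueness half. -/

namespace GenFourier

variable {n : ℕ} {k : ℝ}

lemma gaussWeightedNorm_eq (k : ℝ) (n : ℕ) (c : ℝ) (r : ℝ≥0∞) (g : ℝ → ℂ) :
    gaussWeightedNorm k n c r g =
      eLpNorm (fun x => (Real.exp (n * c * root n x ^ 2) : ℂ) * g x) r (weightedMeasure k n) := by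
  unfold gaussWeightedNorm
  simp_rw [rpow_two_div]

lemma measurable_exp_root (n : ℕ) (c : ℝ) :
    Measurable fun x => (Real.exp (n * c * root n x ^ 2) : ℂ) := by
  fun_prop

lemma exists_hasGaussianDecay (hn : 0 < n) (hα : -(1 / 2) ≤ index k n) {a : ℝ} {p : ℝ≥0∞}
    (hp : 1 ≤ p) {f : ℝ → ℂ}
    (hf : MemLp (fun x => (Real.exp (n * a * root n x ^ 2) : ℂ) * f x) p (weightedMeasure k n)) :
    ∃ M : ℕ, HasGaussianDecay k n a M f := by
  obtain ⟨K, hK⟩ := exists_integrable_one_add_root (k := k) hn hα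
  have hw := integrable_mul_of_memLp hp hf hK (by fun_prop)
    (fun x => by have := root_nonneg n x; positivity)
    (fun x => inv_le_one_of_one_le₀ (one_le_pow₀ (by have := root_nonneg n x; linarith)))
  refine ⟨K, hw.congr (ae_of_all _ fun x => ?_)⟩
  simp only
  push_cast
  ring

lemma measurable_transform (hn : 0 < n) (hα : -(1 / 2) ≤ index k n) {a : ℝ} (ha : 0 < a) {M : ℕ}
    {f : ℝ → ℂ} (hf : HasGaussianDecay k n a M f) : Measurable (transform k n f) := by
  have hα' : -(1 / 2) ≤ index k n + n := by
    have : (0 : ℝ) ≤ n := n.cast_nonneg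
    linarith
  rw [funext (transform_eq hn hα ha hf)]
  have h1 := (hf.differentiable_besselTransform hn ha hα).continuous.measurable
  have h2 := ((hf.id_mul hn).differentiable_besselTransform hn ha hα').continuous.measurable
  fun_prop

/-- The uniqueness part of the Cowling–Price theorem. -/
theorem ae_eq_zero_of_gaussWeightedNorm_lt_top (hn : 0 < n) (hα : -(1 / 2) ≤ index k n) {a b : ℝ}
    (ha : 0 < a) {p q : ℝ≥0∞} (hp : 1 ≤ p) (hq : 1 ≤ q) (hpq : min p q < ∞)
    (hab : 1 / 4 ≤ a * b) {f : ℝ → ℂ} (hfm : AEMeasurable f volume)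
    (hf : gaussWeightedNorm k n a p f < ∞)
    (hTf : gaussWeightedNorm k n b q (transform k n f) < ∞) : f =ᵐ[volume] 0 := by
  have hα' : -(1 / 2) ≤ index k n + n := by
    have : (0 : ℝ) ≤ n := n.cast_nonneg
    linarith
  have hp0 : p ≠ 0 := (one_pos.trans_le hp).ne'
  have hq0 : q ≠ 0 := (one_pos.trans_le hq).ne'
  have hab' : 1 / (4 * a) ≤ b := by
    rw [div_le_iff₀ (by positivity)]
    linarith
  rw [gaussWeightedNorm_eq] at hf hTf
  have hfL : MemLp (fun x => (Real.exp (n * a * root n x ^ 2) : ℂ) * f x) p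
      (weightedMeasure k n) := by
    refine ⟨(measurable_exp_root n a).aestronglyMeasurable.mul ?_, hf⟩
    exact (hfm.mono_ac (weightedMeasure_ac k n)).aestronglyMeasurable
  obtain ⟨M, hM⟩ := exists_hasGaussianDecay hn hα hp hfL
  have hM' := hM.id_mul hn
  have hTL : MemLp (fun y => (Real.exp (n * b * root n y ^ 2) : ℂ) * transform k n f y) q
      (weightedMeasure k n) :=
    ⟨((measurable_exp_root n b).mul (measurable_transform hn hα ha hM)).aestronglyMeasurable, hTf⟩
  have hTLn := hTL.comp_measurePreserving (Measure.measurePreserving_neg (weightedMeasure k n))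
  have hT := transform_eq hn hα ha hM
  set E := besselTransform k n (index k n) f
  set O := besselTransform k n (index k n + n) (fun x => (x : ℂ) * f x)
  have hEL : MemLp (fun x => ((Real.exp (n * b * root n x ^ 2) * root n x ^ 0 : ℝ) : ℂ) *
      E (root n x)) q (weightedMeasure k n) := by
    refine ((hTL.add hTLn).const_mul (1 / 2)).ae_eq (ae_of_all _ fun x => ?_)
    simp only [Pi.add_apply, Function.comp_apply, root_neg, hT]
    push_cast
    ring
  have hOm : Measurable O := (hM'.differentiable_besselTransform hn ha hα').continuous.measurable
  have hOL : MemLp (fun x => ((Real.exp (n * b * root n x ^ 2) * root n x ^ n : ℝ) : ℂ) *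
      O (root n x)) q (weightedMeasure k n) := by
    refine ((hTL.sub hTLn).const_mul (1 / (2 * oddConst k n))).congr_norm
      (by fun_prop : Measurable _).aestronglyMeasurable (ae_of_all _ fun x => ?_)
    have hc := oddConst_ne_zero hn hα
    have : 1 / (2 * oddConst k n) * ((Real.exp (n * b * root n x ^ 2) : ℂ) * transform k n f x -
        (Real.exp (n * b * root n (-x) ^ 2) : ℂ) * transform k n f (-x)) =
        (Real.exp (n * b * root n x ^ 2) : ℂ) * x * O (root n x) := by
      rw [hT, hT, root_neg]
      push_cast
      field_simp
      ring
    simp only [Pi.sub_apply, Function.comp_apply]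
    rw [this, root_pow hn]
    simp
  obtain ⟨P, hP, hPL⟩ := hM.exists_polynomial hn hα ha hα hab' hq 0 hEL
  obtain ⟨Q, hQ, hQL⟩ := hM'.exists_polynomial hn hα ha hα' hab' hq n hOL
  -- The product X^n Q has degree at most 0 while n ≥ 1; this works for q = ∞ as well.
  have hQ0 : Q = 0 := by
    have h1 := polynomial_degree_le_zero_of_memLp hn hα hq0 hQL
    by_contra h0
    rw [Polynomial.degree_mul, Polynomial.degree_X_pow, Polynomial.degree_eq_natDegree h0] at h1
    have h2 : n + Q.natDegree ≤ 0 := by exact_mod_cast h1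
    omega
  have hodd : ∀ᵐ x : ℝ ∂(weightedMeasure k n), (x : ℂ) * f x + ((-x : ℝ) : ℂ) * f (-x) = 0 :=
    hM'.add_neg_eq_zero_of_besselTransform_eq_zero hn ha hα' fun z => by
      rw [hQ, hQ0, Polynomial.eval_zero, zero_mul]
  rw [pow_zero, one_mul] at hPL
  have heven : ∀ᵐ x ∂(weightedMeasure k n), f x + f (-x) = 0 := by
    by_cases hq' : q = ∞
    · have hp' : p ≠ ∞ := by
        rintro rfl
        simp [hq'] at hpq
      have hPC := Polynomial.eq_C_of_degree_le_zero
        (polynomial_degree_le_zero_of_memLp hn hα hq0 hPL)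
      set c₀ : ℂ := (((1 / (2 * a)) ^ (index k n + 1) : ℝ) : ℂ) with hc₀
      have hc₀0 : c₀ ≠ 0 := by
        rw [hc₀, Complex.ofReal_ne_zero]
        positivity
      -- This multiple of the Gaussian has the same Bessel transform as f, so f minus it has zero
      -- even part.
      set C := P.coeff 0 / c₀ with hC
      obtain ⟨K, hK⟩ := hasGaussianDecay_gaussian (k := k) hn hα a
      have hsub : HasGaussianDecay k n a (max M K) fun x => f x - C * gaussian n a x := by
        have mono : ∀ {M M' : ℕ} {ρ : ℝ → ℂ}, M ≤ M' → HasGaussianDecay k n a M ρ →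
            HasGaussianDecay k n a M' ρ := by
          intro M M' ρ hMM hρ
          refine Integrable.mono hρ ((by fun_prop : Measurable _).aestronglyMeasurable.mul
            hρ.aestronglyMeasurable) (ae_of_all _ fun x => ?_)
          have h0 := root_nonneg n x
          rw [norm_mul, norm_mul, Complex.norm_real, Complex.norm_real,
            Real.norm_of_nonneg (by positivity), Real.norm_of_nonneg (by positivity)]
          gcongr
          linarith
        have h1 := mono (le_max_left M K) hM
        have h2 := mono (le_max_right M K) hK
        refine (h1.sub (h2.const_mul C)).congr (ae_of_all _ fun x => ?_)
        simp only [Pi.sub_apply]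
        ring
      have h0 := hsub.add_neg_eq_zero_of_besselTransform_eq_zero hn ha hα fun z => by
        have h1 := (hM.integrable_mul_normBessel hn ha hα z).1
        have h2 := (hK.integrable_mul_normBessel hn ha hα z).1
        have h3 : besselTransform k n (index k n) (fun x => f x - C * gaussian n a x) z =
            besselTransform k n (index k n) f z - C * besselTransform k n (index k n) (gaussian n a) z := by
          unfold besselTransform
          rw [← integral_const_mul, ← integral_sub h1 (h2.const_mul C)]
          congr 1
          ext x
          ring
        rw [h3, hP, besselTransform_gaussian hn hα ha, ← hc₀, hPC, Polynomial.eval_C, hC]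
        field_simp
        ring
      have hfLn := hfL.comp_measurePreserving (Measure.measurePreserving_neg (weightedMeasure k n))
      -- The even part of f times exp(na s²) is constant, and the first condition places that
      -- constant in L^p with p < ∞.
      have hconst : MemLp (fun x => (Polynomial.C (2 * C)).eval (root n x : ℂ)) p
          (weightedMeasure k n) := by
        refine (hfL.add hfLn).ae_eq ?_
        filter_upwards [h0] with x hx
        simp only [Pi.add_apply, Function.comp_apply, root_neg, Polynomial.eval_C]
        have hg : gaussian n a (-x) = gaussian n a x := by simp [gaussian]
        have he : (Real.exp (n * a * root n x ^ 2) : ℂ) * gaussian n a x = 1 := by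
          rw [gaussian, ← Complex.ofReal_mul, ← Real.exp_add, add_neg_cancel, Real.exp_zero,
            Complex.ofReal_one]
        rw [hg] at hx
        have hx' : f x + f (-x) = 2 * C * gaussian n a x := by linear_combination hx
        rw [← mul_add, hx', mul_left_comm, he, mul_one]
      have hC0 := polynomial_eq_zero_of_memLp hn hα hp0 hp' hconst
      rw [Polynomial.C_eq_zero] at hC0
      have hC0' : C = 0 := by simpa using hC0
      filter_upwards [h0] with x hx
      simpa [hC0'] using hx
    · have hP0 := polynomial_eq_zero_of_memLp hn hα hq0 hq' hPL
      exact hM.add_neg_eq_zero_of_besselTransform_eq_zero hn ha hα fun z => by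
        rw [hP, hP0, Polynomial.eval_zero, zero_mul]
  have hne : ∀ᵐ x : ℝ, x ≠ 0 := by simp [ae_iff]
  filter_upwards [(ac_weightedMeasure hn hα).ae_le hodd, (ac_weightedMeasure hn hα).ae_le heven,
    hne] with x h1 h2 h3
  have h4 : (x : ℂ) * (2 * f x) = 0 := by
    push_cast at h1
    linear_combination h1 + x * h2
  have h5 : (x : ℂ) ≠ 0 := by exact_mod_cast h3
  simpa [h5] using h4

/-! ### Gaussian examples below the critical product. -/

lemma memLp_gaussian (hn : 0 < n) (hα : -(1 / 2) ≤ index k n) {c : ℝ} (hc : 0 < c) {p : ℝ≥0∞}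
    (hp : 1 ≤ p) : MemLp (gaussian n c) p (weightedMeasure k n) := by
  have hn' : (0 : ℝ) < n := by exact_mod_cast hn
  have hm : AEStronglyMeasurable (gaussian n c) (weightedMeasure k n) :=
    (measurable_gaussian n c).aestronglyMeasurable
  by_cases hp' : p = ∞
  · subst hp'
    refine memLp_top_of_bound hm 1 (ae_of_all _ fun x => ?_)
    rw [gaussian, Complex.norm_real, Real.norm_of_nonneg (Real.exp_pos _).le, Real.exp_le_one_iff]
    have : 0 ≤ n * c * root n x ^ 2 := by positivity
    linarith
  · have hp0 : p ≠ 0 := (one_pos.trans_le hp).ne'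
    have hpos : 0 < p.toReal := ENNReal.toReal_pos hp0 hp'
    rw [← integrable_norm_rpow_iff hm hp0 hp']
    refine (gaussian_moment hn hα (mul_pos hpos hc) 0).1.congr (ae_of_all _ fun x => ?_)
    simp only [gaussian, mul_zero, pow_zero, mul_one]
    rw [Complex.norm_real, Real.norm_of_nonneg (Real.exp_pos _).le, ← Real.exp_mul]
    congr 1
    ring

lemma exp_mul_gaussian (n : ℕ) (b c : ℝ) (x : ℝ) :
    (Real.exp (n * b * root n x ^ 2) : ℂ) * gaussian n c x = gaussian n (c - b) x := by
  rw [gaussian, gaussian, ← Complex.ofReal_mul, ← Real.exp_add]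
  congr 2
  ring

/-- The transform of a Gaussian. -/
lemma transform_gaussian (hn : 0 < n) (hα : -(1 / 2) ≤ index k n) {c : ℝ} (hc : 0 < c) (y : ℝ) :
    transform k n (gaussian n c) y =
      ((1 / (2 * c)) ^ (index k n + 1) : ℝ) * gaussian n (1 / (4 * c)) y := by
  obtain ⟨K, hK⟩ := hasGaussianDecay_gaussian (k := k) hn hα c
  have hodd : besselTransform k n (index k n + n) (fun x => (x : ℂ) * gaussian n c x)
      (root n y) = 0 := by
    unfold besselTransform
    have h := integral_neg_eq_self (fun x : ℝ => (x : ℂ) * gaussian n c x *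
      normBessel (index k n + n) (n * root n y * root n x)) (weightedMeasure k n)
    simp only [gaussian, root_neg, Complex.ofReal_neg, neg_mul, integral_neg] at h ⊢
    exact self_eq_neg.1 h.symm
  rw [transform_eq hn hα hc hK, hodd, mul_zero, add_zero, besselTransform_gaussian hn hα hc,
    gaussian]
  push_cast
  congr 2
  ring

/-- Continuity upgrades an almost everywhere relation to an identity. Sampled where |x|^(2/n) is a
natural number u, each Gaussian becomes the character u ↦ (e^(-nc))^u, and distinct characters are
independent (Dedekind). -/
lemma linearIndependent_gaussian (hn : 0 < n) {c : ℕ → ℝ} (hc : Function.Injective c)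
    (hm : ∀ m, Measurable (gaussian n (c m))) :
    LinearIndependent ℂ (fun m => AEEqFun.mk (μ := (volume : Measure ℝ)) (gaussian n (c m))
      (hm m).aestronglyMeasurable) := by
  have hn' : (0 : ℝ) < n := by exact_mod_cast hn
  rw [linearIndependent_iff']
  intro s g hg
  have hcoe : ∀ t : Finset ℕ, (⇑(∑ i ∈ t, g i • AEEqFun.mk (μ := (volume : Measure ℝ))
      (gaussian n (c i)) (hm i).aestronglyMeasurable)) =ᵐ[volume]
      fun x => ∑ i ∈ t, g i * gaussian n (c i) x := by
    intro t
    induction t using Finset.induction_on with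
    | empty => simpa using! AEEqFun.coeFn_zero
    | insert i t hi ih =>
      rw [Finset.sum_insert hi]
      filter_upwards [AEEqFun.coeFn_add (g i • AEEqFun.mk (μ := (volume : Measure ℝ))
        (gaussian n (c i)) (hm i).aestronglyMeasurable) (∑ i ∈ t, g i • AEEqFun.mk
        (μ := (volume : Measure ℝ)) (gaussian n (c i)) (hm i).aestronglyMeasurable),
        AEEqFun.coeFn_smul (g i) (AEEqFun.mk (μ := (volume : Measure ℝ)) (gaussian n (c i))
        (hm i).aestronglyMeasurable), AEEqFun.coeFn_mk (μ := (volume : Measure ℝ))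
        (gaussian n (c i)) (hm i).aestronglyMeasurable, ih] with x h1 h2 h3 h4
      rw [h1, Pi.add_apply, h2, Pi.smul_apply, h3, h4, Finset.sum_insert hi, smul_eq_mul]
  have hcont : Continuous fun x => ∑ i ∈ s, g i * gaussian n (c i) x := by
    have := continuous_root n
    unfold gaussian
    fun_prop
  have hae : (fun x => ∑ i ∈ s, g i * gaussian n (c i) x) =ᵐ[volume] fun _ => (0 : ℂ) := by
    have h1 := hcoe s
    rw [hg] at h1
    exact h1.symm.trans AEEqFun.coeFn_zero
  have hzero := (hcont.ae_eq_iff_eq volume continuous_const).1 hae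
  have hli := (linearIndependent_monoidHom (Multiplicative ℕ) ℂ).comp
    (fun m : ℕ => powersHom ℂ ((Real.exp (-(n * c m)) : ℝ) : ℂ)) (by
      intro i j hij
      have h1 := Complex.ofReal_injective ((powersHom ℂ).injective hij)
      have h2 := neg_injective (Real.exp_injective h1)
      exact hc (mul_left_cancel₀ hn'.ne' h2))
  rw [linearIndependent_iff'] at hli
  refine hli s g (funext fun u => ?_)
  -- The point x = (√u)^n has |x|^(2/n) = u.
  have h1 := congrFun hzero (√(Multiplicative.toAdd u : ℕ) ^ n)
  refine Eq.trans ?_ h1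
  simp only [Finset.sum_apply, Pi.smul_apply, Function.comp_apply, smul_eq_mul, powersHom_apply]
  refine Finset.sum_congr rfl fun i _ => ?_
  rw [gaussian, root_pow_of_nonneg hn (Real.sqrt_nonneg _), Real.sq_sqrt (Nat.cast_nonneg _),
    ← Complex.ofReal_pow, ← Real.exp_nat_mul]
  congr 3
  ring

lemma gaussWeightedNorm_gaussian_lt_top (hn : 0 < n) (hα : -(1 / 2) ≤ index k n) {a b c : ℝ}
    (hc : 0 < c) (hac : a < c) (hbc : b < 1 / (4 * c)) {p q : ℝ≥0∞} (hp : 1 ≤ p) (hq : 1 ≤ q) :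
    gaussWeightedNorm k n a p (gaussian n c) < ∞ ∧
      gaussWeightedNorm k n b q (transform k n (gaussian n c)) < ∞ := by
  rw [gaussWeightedNorm_eq, gaussWeightedNorm_eq]
  have hT : (fun x => (Real.exp (n * b * root n x ^ 2) : ℂ) * transform k n (gaussian n c) x) =
      fun x => (((1 / (2 * c)) ^ (index k n + 1) : ℝ) : ℂ) * gaussian n (1 / (4 * c) - b) x := by
    ext x
    rw [transform_gaussian hn hα hc, mul_left_comm, exp_mul_gaussian]
  rw [hT]
  simp_rw [exp_mul_gaussian]
  exact ⟨(memLp_gaussian hn hα (sub_pos.2 hac) hp).2,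
    ((memLp_gaussian hn hα (sub_pos.2 hbc) hq).const_mul _).2⟩

end GenFourier

theorem theorem5p4 (n : ℕ) (hn : 0 < n) (k : ℝ) (hk : ((n : ℝ) - 1) / (2 * n) ≤ k)
    (a b : ℝ) (ha : 0 < a) (hb : 0 < b) (p q : ℝ≥0∞) (hp : 1 ≤ p) (hq : 1 ≤ q)
    (hpq : min p q < ∞) :
    (1 / 4 ≤ a * b → ∀ f : ℝ → ℂ, AEMeasurable f volume →
      GenFourier.gaussWeightedNorm k n a p f < ∞ →
      GenFourier.gaussWeightedNorm k n b q (GenFourier.transform k n f) < ∞ →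
      f =ᵐ[volume] 0) ∧
    (a * b < 1 / 4 → ∃ (f : ℕ → ℝ → ℂ) (hf : ∀ m, Measurable (f m)),
      (∀ m, GenFourier.gaussWeightedNorm k n a p (f m) < ∞ ∧
        GenFourier.gaussWeightedNorm k n b q (GenFourier.transform k n (f m)) < ∞) ∧
      LinearIndependent ℂ
        (fun m => AEEqFun.mk (μ := (volume : Measure ℝ)) (f m)
          (hf m).aestronglyMeasurable)) := by
  have hα := GenFourier.neg_half_le_index hn hk
  refine ⟨fun hab f hfm hf hTf =>
    GenFourier.ae_eq_zero_of_gaussWeightedNorm_lt_top hn hα ha hp hq hpq hab hfm hf hTf,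
    fun hab => ?_⟩
  have hgap : 0 < 1 / (4 * b) - a := by
    rw [sub_pos, lt_div_iff₀ (by positivity)]
    linarith
  -- Distinct points of the open interval (a, 1/(4b)); the shift by 2 keeps the value at m = 0 below
  -- the right endpoint.
  set c : ℕ → ℝ := fun m => a + (1 / (4 * b) - a) / (m + 2) with hc
  have hac : ∀ m, a < c m := fun m => by
    have : 0 < (1 / (4 * b) - a) / ((m : ℝ) + 2) := by positivity
    simp only [hc]
    linarith
  have hcb : ∀ m, b < 1 / (4 * c m) := fun m => by
    have h1 : c m < 1 / (4 * b) := by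
      have : (1 / (4 * b) - a) / ((m : ℝ) + 2) < 1 / (4 * b) - a :=
        div_lt_self hgap (by
          have : (0 : ℝ) ≤ m := m.cast_nonneg
          linarith)
      simp only [hc]
      linarith
    have hcm := ha.trans (hac m)
    rw [lt_div_iff₀ (by positivity)] at h1 ⊢
    linarith
  have hinj : Function.Injective c := by
    intro i j hij
    have hi : (i : ℝ) + 2 ≠ 0 := by positivity
    have hj : (j : ℝ) + 2 ≠ 0 := by positivity
    have h1 := add_left_cancel hij
    rw [div_eq_div_iff hi hj] at h1
    have h2 := mul_left_cancel₀ hgap.ne' h1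
    have h3 : (j : ℝ) = i := by linarith
    exact_mod_cast h3.symm
  refine ⟨fun m => GenFourier.gaussian n (c m), fun m => GenFourier.measurable_gaussian n (c m),
    fun m => ?_, GenFourier.linearIndependent_gaussian hn hinj
      fun m => GenFourier.measurable_gaussian n (c m)⟩
  exact GenFourier.gaussWeightedNorm_gaussian_lt_top hn hα (ha.trans (hac m)) (hac m) (hcb m) hp hq
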